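/- A plane graph is a finite simple graph drawn in the Euclidean plane: its vertices are points of the plane, its edges are polygonal arcs joining two distinct vertices, different edges have different pairs of endpoints, and the interior of an edge contains no vertex and no point of any other edge. Its faces are the connected components of the complement in the plane of the union of its vertices and edges (the unbounded component included), and a face is bounded by a cycle $C$ of the graph if its topological frontier is the union of the vertices and edges of $C$. A pentagulation is a plane graph in which every face is bounded by a cycle of length $5$. Theorem. If $G$ is a pentagulation of diameter $3$, then $G$ contains no $3$-cycle. -/

import Mathlib

/-- The Euclidean plane. -/
abbrev Plane : Type := EuclideanSpace ℝ (Fin 2)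

/-- `IsPolygonalArc e x y`: the point set `e` is a polygonal arc with endpoints `x` and `y`, i.e. the
union of the `n ≥ 1` nondegenerate segments `[p 0, p 1], …, [p (n-1), p n]` of a chain from `x` to `y`
that does not meet itself (consecutive segments meet only in their common endpoint, and all other
pairs of segments are disjoint). -/
def IsPolygonalArc (e : Set Plane) (x y : Plane) : Prop :=
  ∃ (n : ℕ) (p : ℕ → Plane), 1 ≤ n ∧ p 0 = x ∧ p n = y ∧
    (∀ i < n, p i ≠ p (i + 1)) ∧
    (∀ i j : ℕ, i < j → j < n → ∀ z : Plane,
      z ∈ segment ℝ (p i) (p (i + 1)) → z ∈ segment ℝ (p j) (p (j + 1)) → j = i + 1 ∧ z = p j) ∧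
    e = ⋃ i ∈ Set.Iio n, segment ℝ (p i) (p (i + 1))

theorem IsPolygonalArc.symm {e : Set Plane} {x y : Plane} (h : IsPolygonalArc e x y) :
    IsPolygonalArc e y x := by
  obtain ⟨n, p, hn, hx, hy, hne, hs, he⟩ := h
  have key : ∀ i < n, segment ℝ (p (n - i)) (p (n - (i + 1))) =
      segment ℝ (p (n - 1 - i)) (p (n - 1 - i + 1)) := by
    intro i hi
    rw [segment_symm, show n - (i + 1) = n - 1 - i by omega, show n - i = n - 1 - i + 1 by omega]
  refine ⟨n, fun i => p (n - i), hn, by simpa using hy, by simpa using hx, ?_, ?_, ?_⟩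
  · intro i hi
    have := hne (n - 1 - i) (by omega)
    simp only [show n - (i + 1) = n - 1 - i by omega, show n - i = n - 1 - i + 1 by omega]
    exact this.symm
  · intro i j hij hj z hzi hzj
    simp only [key i (by omega)] at hzi
    simp only [key j hj] at hzj
    obtain ⟨h1, h2⟩ := hs (n - 1 - j) (n - 1 - i) (by omega) (by omega) z hzj hzi
    refine ⟨by omega, ?_⟩
    change z = p (n - j)
    rw [h2, show n - j = n - 1 - i by omega]
  · rw [he]
    ext z
    simp only [Set.mem_iUnion, Set.mem_Iio]
    constructor
    · rintro ⟨i, hi, hz⟩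
      refine ⟨n - 1 - i, by omega, ?_⟩
      rw [key _ (by omega), show n - 1 - (n - 1 - i) = i by omega]
      exact hz
    · rintro ⟨i, hi, hz⟩
      rw [key i hi] at hz
      exact ⟨n - 1 - i, by omega, hz⟩

theorem IsPolygonalArc.ne {e : Set Plane} {x y : Plane} (h : IsPolygonalArc e x y) : x ≠ y := by
  obtain ⟨n, p, hn, rfl, rfl, hne, hs, -⟩ := h
  intro hxy
  rcases Nat.lt_or_ge 1 n with h1 | h1
  · obtain ⟨h2, h3⟩ := hs 0 (n - 1) (by omega) (by omega) (p 0) (left_mem_segment ℝ _ _) (by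
      rw [hxy, show n - 1 + 1 = n by omega]
      exact right_mem_segment ℝ _ _)
    apply hne 0 (by omega)
    rw [h3, h2]
  · obtain rfl : n = 1 := by omega
    exact hne 0 (by omega) hxy

/-- A (finite, simple) plane graph: finitely many points of the plane as vertices and finitely many
polygonal arcs as edges, such that every edge joins two vertices, different edges have different
pairs of endpoints, and the interior of an edge contains no vertex and no point of another edge. -/
structure PlaneGraph where
  verts : Finset Plane
  edges : Finset (Set Plane)
  isArc : ∀ e ∈ edges, ∃ x ∈ verts, ∃ y ∈ verts, IsPolygonalArc e x y
  eq_of_endpoints : ∀ e ∈ edges, ∀ e' ∈ edges, ∀ x ∈ verts, ∀ y ∈ verts,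
    IsPolygonalArc e x y → IsPolygonalArc e' x y → e = e'
  disjoint_verts : ∀ e ∈ edges, ∀ x ∈ verts, ∀ y ∈ verts, IsPolygonalArc e x y →
    Disjoint (e \ {x, y}) (verts : Set Plane)
  disjoint_edges : ∀ e ∈ edges, ∀ e' ∈ edges, e ≠ e' → ∀ x ∈ verts, ∀ y ∈ verts,
    IsPolygonalArc e x y → Disjoint (e \ {x, y}) e'

namespace PlaneGraph

/-- The abstract graph of a plane graph. -/
def graph (G : PlaneGraph) : SimpleGraph G.verts where
  Adj x y := ∃ e ∈ G.edges, IsPolygonalArc e (x : Plane) (y : Plane)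
  symm := ⟨fun _ _ ⟨e, he, h⟩ => ⟨e, he, h.symm⟩⟩
  loopless := ⟨fun _ ⟨_, _, h⟩ => h.ne rfl⟩

/-- The point set of a plane graph: all of its vertices and all points of its edges. -/
def pointSet (G : PlaneGraph) : Set Plane :=
  (G.verts : Set Plane) ∪ ⋃ e ∈ G.edges, e

/-- The faces of a plane graph: the connected components of the complement of its point set
(the unbounded one included). -/
def faces (G : PlaneGraph) : Set (Set Plane) :=
  {F | ∃ z ∈ G.pointSetᶜ, F = connectedComponentIn G.pointSetᶜ z}

/-- The point set of the subgraph traversed by a walk: its vertices and the points of its edges. -/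
def walkPointSet (G : PlaneGraph) {u v : G.verts} (c : G.graph.Walk u v) : Set Plane :=
  {z | ∃ w ∈ c.support, z = (w : Plane)} ∪
    {z | ∃ e ∈ G.edges, z ∈ e ∧ ∃ x y : G.verts, s(x, y) ∈ c.edges ∧
      IsPolygonalArc e (x : Plane) (y : Plane)}

/-- The cycle `c` bounds the face `F`: its point set is the frontier of `F`. -/
def Bounds (G : PlaneGraph) {v : G.verts} (c : G.graph.Walk v v) (F : Set Plane) : Prop :=
  c.IsCycle ∧ frontier F = G.walkPointSet c

/-- A pentagulation: every face is bounded by a cycle of length 5. -/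
def IsPentagulation (G : PlaneGraph) : Prop :=
  ∀ F ∈ G.faces, ∃ (v : G.verts) (c : G.graph.Walk v v), c.length = 5 ∧ G.Bounds c F

end PlaneGraph

/-! A triangle has two sides, and a path between them must pass through a vertex of the triangle. If
each side contains a vertex not adjacent to the triangle, two such vertices are at distance at least
4 (`four_le_length`), which contradicts diameter 3.

Suppose instead that every vertex on one side of a triangle is adjacent to the triangle. The
contradiction comes by descent on the number of vertices inside (`false_of_isSmallCycle`). A cycle
of length at most 4 has a vertex `w` on each side, since some face on that side is bounded by a
5-cycle, which has too many vertices to lie on it. This `w` has a neighbour `t` on the triangle and,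
since edges lie on face cycles, a second neighbour `u`. Either `u` is on the triangle, or it has its
own neighbour `t'` there. This gives a triangle, or a quadrilateral `t t' u w`, having a side with
strictly fewer vertices. The quadrilaterals met in the descent have two consecutive vertices from
the original interior, and this suffices to repeat the argument.

The topology replaces the Jordan curve theorem by ray-crossing parity mod 2. Parity is locally
constant off a closed walk (`eventually_parity_eq`) and changes across the edges of a cycle
(`eventually_parity_of_isStraight`), so sides are defined as its level sets. The harder half,
connectedness of a side, has a cohomological form (`exists_eq_or_eq_parity_add`). For a function
locally constant off a cycle, its jumps across edges form a mod 2 edge set. This set is even at each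
vertex because faces are bounded by cycles, and it is contained in the cycle. So it is empty or the
whole cycle. From this, a cycle inside a closed side has a side contained in it
(`exists_side_subset`), as the descent requires. -/

open Filter Topology Set

/-! ### Crossing parity of a single segment. -/

/-- Twice the signed area of the triangle `p q z`. -/
def orient (p q z : Plane) : ℝ := (q 0 - p 0) * (z 1 - p 1) - (q 1 - p 1) * (z 0 - p 0)

open Classical in
/-- The parity of the number of crossings of the upward vertical ray from `z` with the segment from
`p` to `q`; the segment is regarded as half-open, so that every point is treated uniformly. -/
noncomputable def crossing (p q z : Plane) : ZMod 2 :=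
  if (p 0 ≤ z 0 ↔ ¬ q 0 ≤ z 0) ∧ (q 0 - p 0) * orient p q z < 0 then 1 else 0

open Classical in
/-- The correction at an end `p` of a segment which governs how `crossing` varies near `o`. -/
noncomputable def endTerm (o p z : Plane) : ZMod 2 :=
  if p 0 = o 0 ∧ o 1 < p 1 ∧ p 0 ≤ z 0 then 1 else 0

open Classical in
/-- The indicator function of the open half-plane to the left of the line from `p` to `q`. -/
noncomputable def leftSide (p q z : Plane) : ZMod 2 := if 0 < orient p q z then 1 else 0

theorem continuous_orient (p q : Plane) : Continuous (orient p q) := by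
  unfold orient; fun_prop

theorem orient_swap (p q z : Plane) : orient q p z = - orient p q z := by
  unfold orient; ring

theorem orient_combo (p q x y : Plane) {a b : ℝ} (hab : a + b = 1) :
    orient p q (a • x + b • y) = a * orient p q x + b * orient p q y := by
  obtain rfl : b = 1 - a := by linarith
  simp [orient]; ring

theorem convex_orient_pos (p q : Plane) : Convex ℝ {z | 0 < orient p q z} := by
  intro x hx y hy a b ha hb hab
  simp only [mem_ofPred_eq, orient_combo p q x y hab]
  exact convex_Ioi (0 : ℝ) hx hy ha hb hab

theorem convex_orient_neg (p q : Plane) : Convex ℝ {z | orient p q z < 0} := by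
  intro x hx y hy a b ha hb hab
  simp only [mem_ofPred_eq, orient_combo p q x y hab]
  exact convex_Iio (0 : ℝ) hx hy ha hb hab

theorem plane_ext {x y : Plane} (h0 : x 0 = y 0) (h1 : x 1 = y 1) : x = y := by
  ext i; fin_cases i
  · exact h0
  · exact h1

theorem mem_segment_of_coords {p q z : Plane} {t : ℝ} (h0 : 0 ≤ t) (h1 : t ≤ 1)
    (hx : z 0 = p 0 + t * (q 0 - p 0)) (hy : z 1 = p 1 + t * (q 1 - p 1)) : z ∈ segment ℝ p q := by
  rw [segment_eq_image']
  exact ⟨t, ⟨h0, h1⟩, plane_ext (by simp [hx]) (by simp [hy])⟩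

theorem mem_openSegment_coords {p q z : Plane} (h : z ∈ openSegment ℝ p q) :
    ∃ t : ℝ, 0 < t ∧ t < 1 ∧ z 0 = p 0 + t * (q 0 - p 0) ∧ z 1 = p 1 + t * (q 1 - p 1) := by
  rw [openSegment_eq_image'] at h
  obtain ⟨t, ⟨h0, h1⟩, rfl⟩ := h
  exact ⟨t, h0, h1, by simp, by simp⟩

theorem orient_eq_zero_of_mem_segment {p q z : Plane} (h : z ∈ segment ℝ p q) :
    orient p q z = 0 := by
  rw [segment_eq_image'] at h
  obtain ⟨t, -, rfl⟩ := h
  simp [orient]; ring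

theorem sq_add_sq_pos_of_ne {p q : Plane} (h : p ≠ q) : 0 < (q 0 - p 0) ^ 2 + (q 1 - p 1) ^ 2 := by
  by_contra hc
  apply h
  have h0 : (q 0 - p 0) ^ 2 = 0 := by nlinarith [sq_nonneg (q 0 - p 0), sq_nonneg (q 1 - p 1)]
  have h1 : (q 1 - p 1) ^ 2 = 0 := by nlinarith [sq_nonneg (q 0 - p 0), sq_nonneg (q 1 - p 1)]
  rw [sq_eq_zero_iff] at h0 h1
  exact plane_ext (by linarith) (by linarith)

/-- Near a point of an open segment the line through it agrees with the segment. -/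
theorem eventually_mem_segment {p q o : Plane} (hpq : p ≠ q) (ho : o ∈ openSegment ℝ p q) :
    ∀ᶠ z in 𝓝 o, orient p q z = 0 → z ∈ segment ℝ p q := by
  obtain ⟨t, ht0, ht1, hx, hy⟩ := mem_openSegment_coords ho
  have hd := sq_add_sq_pos_of_ne hpq
  let f : Plane → ℝ := fun z => ((z 0 - p 0) * (q 0 - p 0) + (z 1 - p 1) * (q 1 - p 1)) /
    ((q 0 - p 0) ^ 2 + (q 1 - p 1) ^ 2)
  have hf : Continuous f := by
    have : Continuous fun z : Plane => (z 0 - p 0) * (q 0 - p 0) + (z 1 - p 1) * (q 1 - p 1) := by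
      fun_prop
    exact this.div_const _
  have hfo : f o = t := by
    simp only [f, hx, hy]; field_simp; ring
  have h0 : ∀ᶠ z in 𝓝 o, f z ∈ Ioo (0 : ℝ) 1 :=
    hf.continuousAt (isOpen_Ioo.mem_nhds (by rw [hfo]; exact ⟨ht0, ht1⟩))
  filter_upwards [h0] with z hz hor
  unfold orient at hor
  refine mem_segment_of_coords hz.1.le hz.2.le ?_ ?_
  · simp only [f]; field_simp; linear_combination (q 1 - p 1) * hor * (-1)
  · simp only [f]; field_simp; linear_combination (q 0 - p 0) * hor

/-- Every point of a line is a limit of points to the left of it. -/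
theorem frequently_orient_pos {p q o : Plane} (hpq : p ≠ q) (ho : orient p q o = 0) :
    ∃ᶠ z in 𝓝 o, 0 < orient p q z := by
  have hd := sq_add_sq_pos_of_ne hpq
  let g : ℝ → Plane := fun ε => o + ε • (!₂[-(q 1 - p 1), q 0 - p 0] : Plane)
  have hg : Tendsto g (𝓝[>] 0) (𝓝 o) := by
    have hc : Continuous g := by fun_prop
    have := hc.tendsto 0
    simp only [g, zero_smul, add_zero] at this
    exact this.mono_left nhdsWithin_le_nhds
  refine hg.frequently (Eventually.frequently ?_)
  filter_upwards [self_mem_nhdsWithin] with ε hε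
  have hε' : (0 : ℝ) < ε := hε
  have : orient p q (g ε) = orient p q o + ε * ((q 0 - p 0) ^ 2 + (q 1 - p 1) ^ 2) := by
    simp [orient, g]; ring
  rw [this, ho]
  positivity

theorem frequently_orient_neg {p q o : Plane} (hpq : p ≠ q) (ho : orient p q o = 0) :
    ∃ᶠ z in 𝓝 o, orient p q z < 0 := by
  have := frequently_orient_pos hpq.symm (o := o) (by rw [orient_swap, ho, neg_zero])
  refine this.mono fun z hz => ?_
  rw [orient_swap] at hz; linarith

theorem crossing_swap (p q z : Plane) : crossing q p z = crossing p q z := by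
  unfold crossing
  congr 1
  rw [orient_swap, eq_iff_iff]
  refine and_congr (by tauto) ?_
  rw [show (p 0 - q 0) * -orient p q z = (q 0 - p 0) * orient p q z by ring]

theorem zmod_two_add_self (a : ZMod 2) : a + a = 0 := CharTwo.add_self_eq_zero a

theorem eventually_coord_le_iff {o p : Plane} (h : p 0 ≠ o 0) :
    ∀ᶠ z in 𝓝 o, (p 0 ≤ z 0 ↔ p 0 ≤ o 0) := by
  have hc : Continuous fun z : Plane => z 0 := by fun_prop
  rcases lt_or_gt_of_ne h with h | h
  · filter_upwards [hc.continuousAt.eventually (lt_mem_nhds h)] with z hz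
    exact ⟨fun _ => h.le, fun _ => le_of_lt hz⟩
  · filter_upwards [hc.continuousAt.eventually (gt_mem_nhds h)] with z hz
    exact ⟨fun h' => absurd hz (not_lt.2 h'), fun h' => absurd h (not_lt.2 h')⟩

theorem eventually_mul_orient_neg_iff {p q o : Plane} (h : (q 0 - p 0) * orient p q o ≠ 0) :
    ∀ᶠ z in 𝓝 o, ((q 0 - p 0) * orient p q z < 0 ↔ (q 0 - p 0) * orient p q o < 0) := by
  have hc : Continuous fun z : Plane => (q 0 - p 0) * orient p q z :=
    continuous_const.mul (continuous_orient p q)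
  rcases lt_or_gt_of_ne h with h | h
  · filter_upwards [hc.continuousAt.eventually (gt_mem_nhds h)] with z hz
    exact ⟨fun _ => h, fun _ => hz⟩
  · filter_upwards [hc.continuousAt.eventually (lt_mem_nhds h)] with z hz
    exact ⟨fun h' => absurd hz (not_lt.2 h'.le), fun h' => absurd h (not_lt.2 h'.le)⟩

theorem endTerm_of_ne {o p : Plane} (h : p 0 ≠ o 0) (z : Plane) : endTerm o p z = 0 := by
  simp [endTerm, h]

theorem crossing_of_fst_eq {p q : Plane} (h : p 0 = q 0) (z : Plane) : crossing p q z = 0 := by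
  simp [crossing, h]

/-- With `p` on the vertical line through `o` and `q` off it, the position of `z` relative to the
line `p q` is fixed near `o`. Only the test `p 0 ≤ z 0` varies, and it matters exactly when `p` is
above `o`. -/
theorem eventually_crossing_of_fst_eq_left {o p q : Plane} (ho : o ∉ segment ℝ p q)
    (hp : p 0 = o 0) (hq : q 0 ≠ o 0) :
    ∃ K, ∀ᶠ z in 𝓝 o, crossing p q z = K + endTerm o p z + endTerm o q z := by
  have hp1 : p 1 ≠ o 1 := by
    intro h
    exact ho (plane_ext hp h ▸ left_mem_segment ℝ p q)
  have hval : (q 0 - p 0) * orient p q o = (q 0 - p 0) ^ 2 * (o 1 - p 1) := by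
    unfold orient; rw [hp]; ring
  have hsq : 0 < (q 0 - p 0) ^ 2 := by
    have : q 0 - p 0 ≠ 0 := by rw [hp]; exact sub_ne_zero.2 hq
    positivity
  have hne : (q 0 - p 0) * orient p q o ≠ 0 := by
    rw [hval]; exact mul_ne_zero hsq.ne' (sub_ne_zero.2 hp1.symm)
  classical
  -- For `p` above `o`, the crossing equals the end term if `q` is to the right, and its complement
  -- if `q` is to the left.
  refine ⟨if o 1 < p 1 ∧ q 0 ≤ o 0 then 1 else 0, ?_⟩
  filter_upwards [eventually_coord_le_iff hq, eventually_mul_orient_neg_iff hne] with z h1 h2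
  have h3 : (q 0 - p 0) * orient p q o < 0 ↔ o 1 < p 1 := by
    rw [hval, mul_neg_iff]
    constructor
    · rintro (h | h) <;> linarith
    · intro h; left; exact ⟨hsq, by linarith⟩
  rw [endTerm_of_ne hq, add_zero]
  unfold crossing endTerm
  simp only [h1, h2, h3]
  rw [hp]
  by_cases ha : o 1 < p 1 <;> by_cases hb : q 0 ≤ o 0 <;> by_cases hc : o 0 ≤ z 0 <;>
    simp [ha, hb, hc]
  decide

/-- Away from a segment, its crossing parity varies only through the terms of its two ends. -/
theorem eventually_crossing {o p q : Plane} (ho : o ∉ segment ℝ p q) :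
    ∃ K, ∀ᶠ z in 𝓝 o, crossing p q z = K + endTerm o p z + endTerm o q z := by
  by_cases hp : p 0 = o 0 <;> by_cases hq : q 0 = o 0
  · refine ⟨0, Eventually.of_forall fun z => ?_⟩
    rw [crossing_of_fst_eq (hp.trans hq.symm), zero_add]
    -- A point of the vertical line that misses the segment has both ends above it or both below, so
    -- the two end terms cancel.
    have key : o 1 < p 1 ↔ o 1 < q 1 := by
      by_contra hcon
      apply ho
      have hpq : q 1 - p 1 ≠ 0 := by
        intro h
        apply hcon
        rw [show q 1 = p 1 by linarith]
      have : (0 ≤ (o 1 - p 1) / (q 1 - p 1)) ∧ (o 1 - p 1) / (q 1 - p 1) ≤ 1 := by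
        rcases lt_or_gt_of_ne hpq with h | h
        · rw [div_le_one_of_neg h]
          refine ⟨div_nonneg_of_nonpos ?_ h.le, ?_⟩
          · by_contra h'; apply hcon; constructor <;> intro _ <;> linarith
          · by_contra h'; apply hcon; constructor <;> intro _ <;> linarith
        · rw [div_le_one h]
          refine ⟨div_nonneg ?_ h.le, ?_⟩
          · by_contra h'; apply hcon; constructor <;> intro _ <;> linarith
          · by_contra h'; apply hcon; constructor <;> intro _ <;> linarith
      refine mem_segment_of_coords this.1 this.2 ?_ ?_
      · rw [hp, hq]; ring
      · field_simp; ring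
    have : endTerm o p z = endTerm o q z := by
      unfold endTerm; simp only [key, hp, hq]
    rw [this, zmod_two_add_self]
  · exact eventually_crossing_of_fst_eq_left ho hp hq
  · obtain ⟨K, hK⟩ := eventually_crossing_of_fst_eq_left (by rwa [segment_symm]) hq hp
    refine ⟨K, hK.mono fun z hz => ?_⟩
    rw [← crossing_swap, hz]; ring
  · by_cases hside : (p 0 ≤ o 0 ↔ ¬ q 0 ≤ o 0)
    · have hne : (q 0 - p 0) * orient p q o ≠ 0 := by
        have hpq : q 0 - p 0 ≠ 0 := by
          intro h
          rw [show q 0 = p 0 by linarith] at hside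
          tauto
        refine mul_ne_zero hpq fun h => ho ?_
        unfold orient at h
        have : (0 ≤ (o 0 - p 0) / (q 0 - p 0)) ∧ (o 0 - p 0) / (q 0 - p 0) ≤ 1 := by
          rcases lt_or_gt_of_ne hp with h1 | h1
          · have h2 : o 0 < q 0 := not_le.1 (hside.1 h1.le)
            rw [div_le_one (by linarith)]
            exact ⟨div_nonneg (by linarith) (by linarith), by linarith⟩
          · have h2 : q 0 ≤ o 0 := by
              by_contra h'
              exact absurd (hside.2 h') (not_le.2 h1)
            rw [div_le_one_of_neg (by linarith)]
            exact ⟨div_nonneg_of_nonpos (by linarith) (by linarith), by linarith⟩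
        refine mem_segment_of_coords this.1 this.2 ?_ ?_
        · field_simp; ring
        · field_simp; linear_combination h
      refine ⟨crossing p q o, ?_⟩
      filter_upwards [eventually_coord_le_iff hp, eventually_coord_le_iff hq,
        eventually_mul_orient_neg_iff hne] with z h1 h2 h3
      rw [endTerm_of_ne hp, endTerm_of_ne hq, add_zero, add_zero]
      unfold crossing
      simp only [h1, h2, h3]
    · refine ⟨0, ?_⟩
      filter_upwards [eventually_coord_le_iff hp, eventually_coord_le_iff hq] with z h1 h2
      rw [endTerm_of_ne hp, endTerm_of_ne hq, add_zero, add_zero]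
      unfold crossing
      simp only [h1, h2]
      exact if_neg fun h => hside h.1

/-- Across an open segment the crossing parity changes. -/
theorem eventually_crossing_of_mem_openSegment {o p q : Plane} (hpq : p ≠ q)
    (ho : o ∈ openSegment ℝ p q) :
    ∃ K, ∀ᶠ z in 𝓝 o, orient p q z ≠ 0 →
      crossing p q z = K + endTerm o p z + endTerm o q z + leftSide p q z := by
  obtain ⟨t, ht0, ht1, hx, hy⟩ := mem_openSegment_coords ho
  classical
  by_cases h : p 0 = q 0
  · have hq1 : q 1 ≠ p 1 := fun h' => hpq (plane_ext h h'.symm)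
    have ho0 : o 0 = p 0 := by rw [hx, h]; ring
    -- A vertical segment is never crossed. Exactly one of its ends is above `o`, and that end term
    -- is `leftSide` or its complement, according to the direction of the segment.
    refine ⟨if q 1 < p 1 then 0 else 1, Eventually.of_forall fun z hz => ?_⟩
    rw [crossing_of_fst_eq h]
    have hor : orient p q z = (p 1 - q 1) * (z 0 - p 0) := by unfold orient; rw [h]; ring
    rw [hor] at hz
    have hz0 : z 0 ≠ p 0 := fun h' => hz (by rw [h']; ring)
    unfold endTerm leftSide
    rw [hor]
    rcases lt_or_gt_of_ne hq1 with h1 | h1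
    · have h2 : o 1 < p 1 := by nlinarith
      have h3 : ¬ o 1 < q 1 := by nlinarith
      have h4 : 0 < (p 1 - q 1) * (z 0 - p 0) ↔ p 0 ≤ z 0 := by
        rw [mul_pos_iff_of_pos_left (by linarith), sub_pos]
        exact ⟨le_of_lt, fun h => lt_of_le_of_ne h hz0.symm⟩
      simp only [h1, h2, h3, h4, ho0, if_true, true_and, false_and, and_false, if_false, add_zero,
        zero_add]
      exact (zmod_two_add_self _).symm
    · have h2 : ¬ o 1 < p 1 := by nlinarith
      have h3 : o 1 < q 1 := by nlinarith
      have h4 : 0 < (p 1 - q 1) * (z 0 - p 0) ↔ ¬ p 0 ≤ z 0 := by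
        rw [not_le]
        constructor
        · intro h; by_contra h'; nlinarith
        · intro h; nlinarith
      simp only [not_lt.2 h1.le, h2, h3, h4, ho0, ← h, true_and, false_and, and_false,
        if_false, add_zero]
      by_cases h5 : p 0 ≤ z 0 <;> simp [h5] <;> decide
  · have hne : ∀ {a : ℝ}, a ≠ 0 → a * (q 0 - p 0) ≠ 0 := fun ha =>
      mul_ne_zero ha (sub_ne_zero.2 (Ne.symm h))
    have hp : p 0 ≠ o 0 := fun h' => hne ht0.ne' (by linarith)
    have hq : q 0 ≠ o 0 := fun h' => hne (sub_ne_zero.2 ht1.ne') (by linarith)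
    have hside : (p 0 ≤ o 0 ↔ ¬ q 0 ≤ o 0) := by
      rcases lt_or_gt_of_ne h with h1 | h1
      · have : p 0 ≤ o 0 := by nlinarith
        have : ¬ q 0 ≤ o 0 := by nlinarith
        tauto
      · have : ¬ p 0 ≤ o 0 := by nlinarith
        have : q 0 ≤ o 0 := by nlinarith
        tauto
    -- The ray crosses when `z` is below the segment, which is its right side if the segment runs
    -- rightwards and its left side otherwise.
    refine ⟨if p 0 < q 0 then 1 else 0, ?_⟩
    filter_upwards [eventually_coord_le_iff hp, eventually_coord_le_iff hq] with z h1 h2 hz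
    rw [endTerm_of_ne hp, endTerm_of_ne hq, add_zero, add_zero]
    unfold crossing leftSide
    simp only [h1, h2]
    rcases lt_or_gt_of_ne h with h3 | h3
    · have h4 : (q 0 - p 0) * orient p q z < 0 ↔ ¬ 0 < orient p q z := by
        rw [mul_neg_iff, not_lt]
        constructor
        · rintro (h | h)
          · exact h.2.le
          · linarith
        · intro h; left; exact ⟨by linarith, lt_of_le_of_ne h hz⟩
      by_cases h5 : 0 < orient p q z <;> simp [hside, h3, h4, h5]
      decide
    · have h4 : (q 0 - p 0) * orient p q z < 0 ↔ 0 < orient p q z := by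
        rw [mul_neg_iff]
        constructor
        · rintro (h | h)
          · linarith
          · exact h.2
        · intro h; right; exact ⟨by linarith, h⟩
      simp [hside, h4, not_lt.2 h3.le]

/-! ### Polygonal chains and sums along walks. -/

/-- `e` is the union of the segments of the simple chain `p 0, …, p n`. -/
def IsPolygonalChain (e : Set Plane) (n : ℕ) (p : ℕ → Plane) : Prop :=
  1 ≤ n ∧ (∀ i < n, p i ≠ p (i + 1)) ∧
    (∀ i j : ℕ, i < j → j < n → ∀ z : Plane,
      z ∈ segment ℝ (p i) (p (i + 1)) → z ∈ segment ℝ (p j) (p (j + 1)) → j = i + 1 ∧ z = p j) ∧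
    e = ⋃ i ∈ Set.Iio n, segment ℝ (p i) (p (i + 1))

theorem isPolygonalArc_iff {e : Set Plane} {x y : Plane} :
    IsPolygonalArc e x y ↔ ∃ n p, IsPolygonalChain e n p ∧ p 0 = x ∧ p n = y := by
  constructor
  · rintro ⟨n, p, h1, h2, h3, h4, h5, h6⟩
    exact ⟨n, p, ⟨h1, h4, h5, h6⟩, h2, h3⟩
  · rintro ⟨n, p, ⟨h1, h4, h5, h6⟩, h2, h3⟩
    exact ⟨n, p, h1, h2, h3, h4, h5, h6⟩

theorem left_ne_of_mem_openSegment {p q o : Plane} (hpq : p ≠ q) (ho : o ∈ openSegment ℝ p q) :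
    o ≠ p := by
  rintro rfl
  exact hpq (left_mem_openSegment_iff.1 ho)

theorem right_ne_of_mem_openSegment {p q o : Plane} (hpq : p ≠ q) (ho : o ∈ openSegment ℝ p q) :
    o ≠ q := by
  rintro rfl
  exact hpq (right_mem_openSegment_iff.1 ho)

namespace IsPolygonalChain

variable {e : Set Plane} {n : ℕ} {p : ℕ → Plane}

theorem mem_iff (h : IsPolygonalChain e n p) {z : Plane} :
    z ∈ e ↔ ∃ i < n, z ∈ segment ℝ (p i) (p (i + 1)) := by
  rw [h.2.2.2]; simp

theorem node_mem (h : IsPolygonalChain e n p) {i : ℕ} (hi : i ≤ n) : p i ∈ e := by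
  rw [h.mem_iff]
  rcases Nat.lt_or_ge i n with h' | h'
  · exact ⟨i, h', left_mem_segment ℝ _ _⟩
  · obtain rfl : i = n := le_antisymm hi h'
    have := h.1
    refine ⟨i - 1, by omega, ?_⟩
    rw [show i - 1 + 1 = i by omega]
    exact right_mem_segment ℝ _ _

theorem eq_of_mem_openSegment (h : IsPolygonalChain e n p) {i j : ℕ} (hi : i < n) (hj : j < n)
    {o : Plane} (ho : o ∈ openSegment ℝ (p i) (p (i + 1)))
    (ho' : o ∈ segment ℝ (p j) (p (j + 1))) : j = i := by
  have hs := openSegment_subset_segment ℝ _ _ ho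
  rcases lt_trichotomy i j with hij | hij | hij
  · obtain ⟨rfl, h2⟩ := h.2.2.1 i j hij hj o hs ho'
    exact absurd h2 (right_ne_of_mem_openSegment (h.2.1 i hi) ho)
  · exact hij.symm
  · obtain ⟨rfl, h2⟩ := h.2.2.1 j i hij hi o ho' hs
    exact absurd h2 (left_ne_of_mem_openSegment (h.2.1 _ hi) ho)

theorem ne_first (h : IsPolygonalChain e n p) {i : ℕ} (hi : i < n)
    {o : Plane} (ho : o ∈ openSegment ℝ (p i) (p (i + 1))) : o ≠ p 0 := by
  rintro rfl
  obtain rfl := h.eq_of_mem_openSegment hi (lt_of_le_of_lt (Nat.zero_le _) hi) ho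
    (left_mem_segment ℝ _ _)
  exact left_ne_of_mem_openSegment (h.2.1 _ hi) ho rfl

theorem ne_last (h : IsPolygonalChain e n p) {i : ℕ} (hi : i < n)
    {o : Plane} (ho : o ∈ openSegment ℝ (p i) (p (i + 1))) : o ≠ p n := by
  rintro rfl
  have h1 : n - 1 + 1 = n := by omega
  have h2 := h.eq_of_mem_openSegment hi (j := n - 1) (by omega) ho
    (by rw [h1]; exact right_mem_segment ℝ _ _)
  rw [← h2, h1] at ho
  have h3 := h.2.1 (n - 1) (by omega)
  rw [h1] at h3
  exact right_ne_of_mem_openSegment h3 ho rfl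

theorem isPolygonalArc (h : IsPolygonalChain e n p) : IsPolygonalArc e (p 0) (p n) :=
  isPolygonalArc_iff.2 ⟨n, p, h, rfl, rfl⟩

end IsPolygonalChain

/-- The local variation of the crossing parity of a chain, from that of its segments. -/
theorem eventually_sum_crossing {l : Filter Plane} {o : Plane} {p : ℕ → Plane}
    {g : ℕ → Plane → ZMod 2} (n : ℕ)
    (h : ∀ i < n, ∃ K, ∀ᶠ z in l, crossing (p i) (p (i + 1)) z =
      K + endTerm o (p i) z + endTerm o (p (i + 1)) z + g i z) :
    ∃ K, ∀ᶠ z in l, ∑ i ∈ Finset.range n, crossing (p i) (p (i + 1)) z =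
      K + endTerm o (p 0) z + endTerm o (p n) z + ∑ i ∈ Finset.range n, g i z := by
  induction n with
  | zero =>
    refine ⟨0, Eventually.of_forall fun z => ?_⟩
    simp [zmod_two_add_self]
  | succ n ih =>
    obtain ⟨K, hK⟩ := ih fun i hi => h i (by omega)
    obtain ⟨K', hK'⟩ := h n (by omega)
    refine ⟨K + K', ?_⟩
    filter_upwards [hK, hK'] with z h1 h2
    rw [Finset.sum_range_succ, Finset.sum_range_succ, h1, h2]
    linear_combination zmod_two_add_self (endTerm o (p n) z)

theorem eventually_list_sum {α : Type*} {l : Filter Plane} {f g : α → Plane → ZMod 2} (L : List α)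
    (h : ∀ a ∈ L, ∃ K, ∀ᶠ z in l, f a z = K + g a z) :
    ∃ K, ∀ᶠ z in l, (L.map fun a => f a z).sum = K + (L.map fun a => g a z).sum := by
  induction L with
  | nil => exact ⟨0, by simp⟩
  | cons a L ih =>
    obtain ⟨K, hK⟩ := ih fun b hb => h b (List.mem_cons_of_mem _ hb)
    obtain ⟨K', hK'⟩ := h a List.mem_cons_self
    refine ⟨K + K', ?_⟩
    filter_upwards [hK, hK'] with z h1 h2
    simp only [List.map_cons, List.sum_cons, h1, h2]
    ring

/-- Telescoping mod 2: inner vertices count twice. For a closed walk the total vanishes, which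
removes all end terms from its parity. -/
theorem sum_darts_ends {V : Type*} {H : SimpleGraph V} (f : V → ZMod 2) {u v : V}
    (c : H.Walk u v) : (c.darts.map fun d => f d.fst + f d.snd).sum = f u + f v := by
  induction c with
  | nil => simp [zmod_two_add_self]
  | @cons u v w h c ih =>
    simp only [SimpleGraph.Walk.darts_cons, List.map_cons, List.sum_cons, ih]
    linear_combination zmod_two_add_self (f v)

/-! ### Edges of a plane graph as arcs between vertices. -/

namespace PlaneGraph

variable (G : PlaneGraph)

theorem exists_chain {e : Set Plane} (he : e ∈ G.edges) :
    ∃ np : ℕ × (ℕ → Plane), IsPolygonalChain e np.1 np.2 ∧ np.2 0 ∈ G.verts ∧ np.2 np.1 ∈ G.verts := by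
  obtain ⟨x, hx, y, hy, h⟩ := G.isArc e he
  obtain ⟨n, p, hp, rfl, rfl⟩ := isPolygonalArc_iff.1 h
  exact ⟨(n, p), hp, hx, hy⟩

open Classical in
/-- A chain of segments chosen for each edge. -/
noncomputable def chain (e : Set Plane) : ℕ × (ℕ → Plane) :=
  if he : e ∈ G.edges then (G.exists_chain he).choose else (0, fun _ => 0)

variable {G}

theorem chain_spec {e : Set Plane} (he : e ∈ G.edges) :
    IsPolygonalChain e (G.chain e).1 (G.chain e).2 ∧ (G.chain e).2 0 ∈ G.verts ∧
      (G.chain e).2 (G.chain e).1 ∈ G.verts := by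
  rw [chain, dif_pos he]
  exact (G.exists_chain he).choose_spec

variable (G) in
open Classical in
/-- The edge joining two adjacent vertices. -/
noncomputable def arc (x y : G.verts) : Set Plane :=
  if h : G.graph.Adj x y then h.choose else ∅

theorem arc_mem {x y : G.verts} (h : G.graph.Adj x y) : G.arc x y ∈ G.edges := by
  rw [arc, dif_pos h]
  exact h.choose_spec.1

theorem isPolygonalArc_arc {x y : G.verts} (h : G.graph.Adj x y) :
    IsPolygonalArc (G.arc x y) x y := by
  rw [arc, dif_pos h]
  exact h.choose_spec.2

theorem eq_arc {x y : G.verts} {e : Set Plane} (he : e ∈ G.edges) (h : IsPolygonalArc e x y) :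
    e = G.arc x y := by
  have hadj : G.graph.Adj x y := ⟨e, he, h⟩
  exact G.eq_of_endpoints _ he _ (arc_mem hadj) x x.2 y y.2 h (isPolygonalArc_arc hadj)

theorem arc_comm {x y : G.verts} (h : G.graph.Adj x y) : G.arc y x = G.arc x y :=
  eq_arc (arc_mem h.symm) (isPolygonalArc_arc h.symm).symm

theorem eq_or_eq_of_mem_arc {x y v : G.verts} (h : G.graph.Adj x y) (hv : (v : Plane) ∈ G.arc x y) :
    v = x ∨ v = y := by
  by_contra hc
  push Not at hc
  have := G.disjoint_verts _ (arc_mem h) x x.2 y y.2 (isPolygonalArc_arc h)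
  refine Set.disjoint_left.1 this ⟨hv, ?_⟩ v.2
  simp [hc]

theorem _root_.IsPolygonalArc.left_mem {e : Set Plane} {x y : Plane} (h : IsPolygonalArc e x y) :
    x ∈ e := by
  obtain ⟨n, p, hp, rfl, rfl⟩ := isPolygonalArc_iff.1 h
  exact hp.node_mem (Nat.zero_le _)

theorem _root_.IsPolygonalArc.right_mem {e : Set Plane} {x y : Plane} (h : IsPolygonalArc e x y) :
    y ∈ e := h.symm.left_mem

theorem ends_eq {x y x' y' : G.verts} (h : G.graph.Adj x y)
    (h' : IsPolygonalArc (G.arc x y) x' y') : s(x, y) = s(x', y') := by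
  have hne : x' ≠ y' := fun hc => h'.ne (by rw [hc])
  rw [Sym2.eq_iff]
  rcases eq_or_eq_of_mem_arc h h'.left_mem with rfl | rfl <;>
  rcases eq_or_eq_of_mem_arc h h'.right_mem with rfl | rfl <;> tauto

theorem arc_eq_arc_iff {x y x' y' : G.verts} (h : G.graph.Adj x y) (h' : G.graph.Adj x' y') :
    G.arc x y = G.arc x' y' ↔ s(x, y) = s(x', y') := by
  constructor
  · intro he
    exact ends_eq h (he ▸ isPolygonalArc_arc h')
  · intro hs
    rcases Sym2.eq_iff.1 hs with ⟨rfl, rfl⟩ | ⟨rfl, rfl⟩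
    · rfl
    · exact (arc_comm h').symm ▸ rfl

theorem exists_eq_arc {e : Set Plane} (he : e ∈ G.edges) :
    ∃ x y : G.verts, G.graph.Adj x y ∧ e = G.arc x y := by
  obtain ⟨x, hx, y, hy, h⟩ := G.isArc e he
  exact ⟨⟨x, hx⟩, ⟨y, hy⟩, ⟨e, he, h⟩, eq_arc (x := ⟨x, hx⟩) (y := ⟨y, hy⟩) he h⟩

/-- The chosen chain may run from `x` to `y` or back; a symmetric expression in its ends does not
see the direction. -/
theorem chain_ends (f : Plane → ZMod 2) {x y : G.verts} (h : G.graph.Adj x y) :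
    f ((G.chain (G.arc x y)).2 0) + f ((G.chain (G.arc x y)).2 (G.chain (G.arc x y)).1) =
      f x + f y := by
  obtain ⟨h1, h2, h3⟩ := chain_spec (arc_mem h)
  have := ends_eq (x' := ⟨_, h2⟩) (y' := ⟨_, h3⟩) h h1.isPolygonalArc
  rcases Sym2.eq_iff.1 this with ⟨h4, h5⟩ | ⟨h4, h5⟩
  · rw [congrArg Subtype.val h4, congrArg Subtype.val h5]
  · rw [congrArg Subtype.val h4, congrArg Subtype.val h5, add_comm]

theorem mem_walkPointSet {u v : G.verts} {c : G.graph.Walk u v} {z : Plane} :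
    z ∈ G.walkPointSet c ↔ (∃ w ∈ c.support, z = (w : Plane)) ∨
      ∃ x y, G.graph.Adj x y ∧ s(x, y) ∈ c.edges ∧ z ∈ G.arc x y := by
  refine or_congr Iff.rfl ?_
  constructor
  · rintro ⟨e, he, hz, x, y, hs, h⟩
    exact ⟨x, y, ⟨e, he, h⟩, hs, eq_arc he h ▸ hz⟩
  · rintro ⟨x, y, h, hs, hz⟩
    exact ⟨_, arc_mem h, hz, x, y, hs, isPolygonalArc_arc h⟩

theorem arc_subset_walkPointSet {u v x y : G.verts} {c : G.graph.Walk u v} (h : s(x, y) ∈ c.edges) :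
    G.arc x y ⊆ G.walkPointSet c := fun _ hz =>
  mem_walkPointSet.2 (Or.inr ⟨x, y, c.adj_of_mem_edges h, h, hz⟩)

theorem coe_mem_walkPointSet {u v w : G.verts} {c : G.graph.Walk u v} :
    (w : Plane) ∈ G.walkPointSet c ↔ w ∈ c.support := by
  constructor
  · intro h
    rcases mem_walkPointSet.1 h with ⟨w', hw', he⟩ | ⟨x, y, hadj, hs, hw⟩
    · rwa [Subtype.ext he]
    · rcases eq_or_eq_of_mem_arc hadj hw with rfl | rfl
      · exact c.fst_mem_support_of_mem_edges hs
      · exact c.snd_mem_support_of_mem_edges hs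
  · exact fun h => mem_walkPointSet.2 (Or.inl ⟨w, h, rfl⟩)

theorem arc_subset_pointSet {x y : G.verts} (h : G.graph.Adj x y) : G.arc x y ⊆ G.pointSet :=
  fun _ hz => Or.inr (Set.mem_biUnion (arc_mem h) hz)

theorem walkPointSet_subset {u v : G.verts} (c : G.graph.Walk u v) :
    G.walkPointSet c ⊆ G.pointSet := by
  intro z hz
  rcases mem_walkPointSet.1 hz with ⟨w, -, rfl⟩ | ⟨x, y, h, -, hz⟩
  · exact Or.inl w.2
  · exact arc_subset_pointSet h hz

/-! ### Crossing parity of walks, off the walk and across its edges. -/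

variable (G) in
/-- The crossing parity of an edge. -/
noncomputable def edgeParity (e : Set Plane) (z : Plane) : ZMod 2 :=
  ∑ i ∈ Finset.range (G.chain e).1, crossing ((G.chain e).2 i) ((G.chain e).2 (i + 1)) z

/-- The crossing parity of a walk: for a closed walk, it tells the two sides apart. -/
noncomputable def parity {u v : G.verts} (c : G.graph.Walk u v) (z : Plane) : ZMod 2 :=
  (c.darts.map fun d => G.edgeParity (G.arc d.fst d.snd) z).sum

theorem eventually_edgeParity {x y : G.verts} (h : G.graph.Adj x y) {o : Plane}
    (ho : o ∉ G.arc x y) :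
    ∃ K, ∀ᶠ z in 𝓝 o, G.edgeParity (G.arc x y) z = K + (endTerm o x z + endTerm o y z) := by
  obtain ⟨h1, -, -⟩ := chain_spec (arc_mem h)
  obtain ⟨K, hK⟩ := eventually_sum_crossing (l := 𝓝 o) (o := o) (p := (G.chain (G.arc x y)).2)
    (g := fun _ _ => 0) (G.chain (G.arc x y)).1 (fun i hi => by
      obtain ⟨K, hK⟩ := eventually_crossing (o := o) (p := (G.chain (G.arc x y)).2 i)
        (q := (G.chain (G.arc x y)).2 (i + 1)) (fun hc => ho (h1.mem_iff.2 ⟨i, hi, hc⟩))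
      exact ⟨K, by simpa using hK⟩)
  refine ⟨K, hK.mono fun z hz => ?_⟩
  rw [edgeParity, hz, ← chain_ends (fun p => endTerm o p z) h]
  simp [add_assoc]

/-- The crossing parity of a closed walk is locally constant away from the walk. -/
theorem eventually_parity_eq {v : G.verts} (c : G.graph.Walk v v) {o : Plane}
    (ho : o ∉ G.walkPointSet c) : ∀ᶠ z in 𝓝 o, parity c z = parity c o := by
  obtain ⟨K, hK⟩ := eventually_list_sum (l := 𝓝 o)
    (f := fun d : G.graph.Dart => G.edgeParity (G.arc d.fst d.snd))
    (g := fun d z => endTerm o d.fst z + endTerm o d.snd z) c.darts (fun d hd =>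
      eventually_edgeParity d.adj fun hc =>
        ho (arc_subset_walkPointSet (c := c) (List.mem_map_of_mem (f := SimpleGraph.Dart.edge) hd) hc))
  have hK' : ∀ᶠ z in 𝓝 o, parity c z = K := by
    refine hK.mono fun z hz => ?_
    rw [parity, hz, sum_darts_ends (fun w : G.verts => endTerm o w z), zmod_two_add_self, add_zero]
  exact hK'.mono fun z hz => hz.trans hK'.self_of_nhds.symm

variable (G) in
/-- `o` lies in the interior of the segment `[p, q]` of the chain of `e`. -/
def IsStraight (e : Set Plane) (p q o : Plane) : Prop :=
  ∃ i < (G.chain e).1, p = (G.chain e).2 i ∧ q = (G.chain e).2 (i + 1) ∧ o ∈ openSegment ℝ p q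

namespace IsStraight

variable {e : Set Plane} {p q o : Plane}

theorem ne (h : G.IsStraight e p q o) (he : e ∈ G.edges) : p ≠ q := by
  obtain ⟨i, hi, rfl, rfl, -⟩ := h
  exact (chain_spec he).1.2.1 i hi

theorem mem (h : G.IsStraight e p q o) (he : e ∈ G.edges) : o ∈ e := by
  obtain ⟨i, hi, rfl, rfl, ho⟩ := h
  exact (chain_spec he).1.mem_iff.2 ⟨i, hi, openSegment_subset_segment ℝ _ _ ho⟩

theorem orient_eq_zero (h : G.IsStraight e p q o) : orient p q o = 0 := by
  obtain ⟨i, hi, rfl, rfl, ho⟩ := h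
  exact orient_eq_zero_of_mem_segment (openSegment_subset_segment ℝ _ _ ho)

theorem mem_interior (h : G.IsStraight e p q o) (he : e ∈ G.edges) :
    o ∈ e \ {(G.chain e).2 0, (G.chain e).2 (G.chain e).1} := by
  refine ⟨h.mem he, ?_⟩
  obtain ⟨i, hi, rfl, rfl, ho⟩ := h
  obtain ⟨h1, -, -⟩ := chain_spec he
  simp [h1.ne_first hi ho, h1.ne_last hi ho]

theorem not_mem_verts (h : G.IsStraight e p q o) (he : e ∈ G.edges) : o ∉ G.verts := by
  obtain ⟨h1, h2, h3⟩ := chain_spec he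
  exact Set.disjoint_left.1 (G.disjoint_verts e he _ h2 _ h3 h1.isPolygonalArc)
    (h.mem_interior he)

theorem eq_of_mem (h : G.IsStraight e p q o) (he : e ∈ G.edges) {e' : Set Plane}
    (he' : e' ∈ G.edges) (ho : o ∈ e') : e' = e := by
  by_contra hne
  obtain ⟨h1, h2, h3⟩ := chain_spec he
  exact Set.disjoint_left.1 (G.disjoint_edges e he e' he' (Ne.symm hne) _ h2 _ h3
    h1.isPolygonalArc) (h.mem_interior he) ho

theorem mem_walkPointSet_iff {x y : G.verts} (hadj : G.graph.Adj x y)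
    (h : G.IsStraight (G.arc x y) p q o) {u v : G.verts} {c : G.graph.Walk u v} :
    o ∈ G.walkPointSet c ↔ s(x, y) ∈ c.edges := by
  constructor
  · intro ho
    rcases PlaneGraph.mem_walkPointSet.1 ho with ⟨w, -, rfl⟩ | ⟨x', y', hadj', hs, ho⟩
    · exact absurd w.2 (h.not_mem_verts (arc_mem hadj))
    · rw [← (arc_eq_arc_iff hadj' hadj).1 (h.eq_of_mem (arc_mem hadj) (arc_mem hadj') ho)]
      exact hs
  · exact fun hs => arc_subset_walkPointSet hs (h.mem (arc_mem hadj))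

end IsStraight

/-- Only one segment of the chain passes through `o`, and it alone contributes a jump. The end terms
at inner nodes cancel in pairs. -/
theorem eventually_edgeParity_of_isStraight {x y : G.verts} (h : G.graph.Adj x y) {p q o : Plane}
    (ho : G.IsStraight (G.arc x y) p q o) :
    ∃ K, ∀ᶠ z in 𝓝 o ⊓ 𝓟 {z | orient p q z ≠ 0}, G.edgeParity (G.arc x y) z =
      K + (endTerm o x z + endTerm o y z + leftSide p q z) := by
  obtain ⟨h1, -, -⟩ := chain_spec (arc_mem h)
  obtain ⟨i, hi, rfl, rfl, ho⟩ := ho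
  obtain ⟨K, hK⟩ := eventually_sum_crossing
    (l := 𝓝 o ⊓ 𝓟 {z | orient ((G.chain (G.arc x y)).2 i) ((G.chain (G.arc x y)).2 (i + 1)) z ≠ 0})
    (o := o) (p := (G.chain (G.arc x y)).2)
    (g := fun j z => if j = i then
      leftSide ((G.chain (G.arc x y)).2 i) ((G.chain (G.arc x y)).2 (i + 1)) z else 0)
    (G.chain (G.arc x y)).1 (fun j hj => by
      by_cases hji : j = i
      · subst hji
        obtain ⟨K, hK⟩ := eventually_crossing_of_mem_openSegment (h1.2.1 j hj) ho
        refine ⟨K, eventually_inf_principal.2 (hK.mono fun z hz hz' => ?_)⟩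
        rw [hz hz', if_pos rfl]
      · obtain ⟨K, hK⟩ := eventually_crossing (o := o) (p := (G.chain (G.arc x y)).2 j)
          (q := (G.chain (G.arc x y)).2 (j + 1))
          (fun hc => hji (h1.eq_of_mem_openSegment hi hj ho hc))
        refine ⟨K, eventually_inf_principal.2 (hK.mono fun z hz _ => ?_)⟩
        rw [hz, if_neg hji, add_zero])
  refine ⟨K, hK.mono fun z hz => ?_⟩
  rw [edgeParity, hz, ← chain_ends (fun p => endTerm o p z) h,
    Finset.sum_ite_eq' , if_pos (Finset.mem_range.2 hi)]
  ring

/-- The crossing parity of a cycle changes across each of its edges. -/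
theorem eventually_parity_of_isStraight {x y : G.verts} (h : G.graph.Adj x y) {p q o : Plane}
    (ho : G.IsStraight (G.arc x y) p q o) {v : G.verts} {c : G.graph.Walk v v} (hc : c.IsCycle)
    (hs : s(x, y) ∈ c.edges) :
    ∃ K, ∀ᶠ z in 𝓝 o, orient p q z ≠ 0 → parity c z = K + leftSide p q z := by
  classical
  obtain ⟨K, hK⟩ := eventually_list_sum (l := 𝓝 o ⊓ 𝓟 {z | orient p q z ≠ 0})
    (f := fun d : G.graph.Dart => G.edgeParity (G.arc d.fst d.snd))
    (g := fun d z => (endTerm o d.fst z + endTerm o d.snd z) +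
      if d.edge = s(x, y) then leftSide p q z else 0) c.darts (fun d hd => by
      by_cases hd' : d.edge = s(x, y)
      · have hda : G.arc d.fst d.snd = G.arc x y := (arc_eq_arc_iff d.adj h).2 hd'
        obtain ⟨K, hK⟩ := eventually_edgeParity_of_isStraight d.adj (hda ▸ ho)
        refine ⟨K, hK.mono fun z hz => ?_⟩
        rw [hz, if_pos hd']
      · obtain ⟨K, hK⟩ := eventually_edgeParity (o := o) d.adj (fun hc' => hd'
          ((arc_eq_arc_iff d.adj h).1 (ho.eq_of_mem (arc_mem h) (arc_mem d.adj) hc')))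
        refine ⟨K, (hK.filter_mono inf_le_left).mono fun z hz => ?_⟩
        rw [hz, if_neg hd', add_zero])
  refine ⟨K, (eventually_inf_principal.1 hK).mono fun z hz hz' => ?_⟩
  rw [parity, hz hz', List.sum_map_add, sum_darts_ends (fun w : G.verts => endTerm o w z),
    zmod_two_add_self, zero_add]
  congr 1
  have h1 : (c.darts.map fun d => if d.edge = s(x, y) then leftSide p q z else 0) =
      c.edges.map fun s => if s = s(x, y) then leftSide p q z else 0 := by
    rw [SimpleGraph.Walk.edges, List.map_map]; rfl
  -- A cycle uses the edge exactly once, so the jump survives mod 2.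
  rw [h1, List.sum_map_ite_eq, List.count_eq_one_of_mem hc.isTrail.edges_nodup hs]
  simp

end PlaneGraph

/-! ### The point set of a plane graph and its local shape at an edge. -/

theorem isClosed_segment_plane (p q : Plane) : IsClosed (segment ℝ p q) := by
  rw [segment_eq_image']
  exact (isCompact_Icc.image (by fun_prop)).isClosed

theorem dense_compl_segment {p q : Plane} (hpq : p ≠ q) : Dense (segment ℝ p q)ᶜ := by
  intro z
  by_cases hz : z ∈ segment ℝ p q
  · refine mem_closure_iff_frequently.2
      ((frequently_orient_pos hpq (orient_eq_zero_of_mem_segment hz)).mono fun w hw hw' => ?_)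
    exact hw.ne' (orient_eq_zero_of_mem_segment hw')
  · exact subset_closure hz

/-- A locally constant function on a preconnected set is constant. -/
theorem IsPreconnected.eq_of_eventually_eq {A : Set Plane} (hA : IsPreconnected A)
    {s : Plane → ZMod 2} (hs : ∀ z ∈ A, ∀ᶠ w in 𝓝 z, s w = s z) {x y : Plane} (hx : x ∈ A)
    (hy : y ∈ A) : s x = s y := by
  let _ : TopologicalSpace (ZMod 2) := ⊥
  have : DiscreteTopology (ZMod 2) := ⟨rfl⟩
  refine hA.constant (f := s) (fun z hz => ContinuousAt.continuousWithinAt ?_) hx hy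
  exact (continuousAt_const (y := s z)).congr ((hs z hz).mono fun w hw => hw.symm)

namespace PlaneGraph

variable {G : PlaneGraph}

variable (G) in
/-- The points and segments which make up a plane graph. -/
def pieces : Set (Set Plane) :=
  (fun v => {v}) '' (G.verts : Set Plane) ∪ ⋃ e ∈ G.edges,
    (fun i => segment ℝ ((G.chain e).2 i) ((G.chain e).2 (i + 1))) '' Set.Iio (G.chain e).1

variable (G) in
theorem finite_pieces : G.pieces.Finite := by
  refine (G.verts.finite_toSet.image _).union ?_
  exact G.edges.finite_toSet.biUnion fun e _ => (Set.finite_Iio _).image _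

theorem mem_pieces {A : Set Plane} : A ∈ G.pieces ↔ (∃ v ∈ G.verts, A = {v}) ∨
    ∃ e ∈ G.edges, ∃ i < (G.chain e).1,
      A = segment ℝ ((G.chain e).2 i) ((G.chain e).2 (i + 1)) := by
  simp [pieces, eq_comm]

variable (G) in
theorem sUnion_pieces : ⋃₀ G.pieces = G.pointSet := by
  ext z
  constructor
  · rintro ⟨A, hA, hz⟩
    rcases mem_pieces.1 hA with ⟨v, hv, rfl⟩ | ⟨e, he, i, hi, rfl⟩
    · exact Or.inl (by rw [Set.mem_singleton_iff.1 hz]; exact hv)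
    · exact Or.inr (Set.mem_biUnion he ((chain_spec he).1.mem_iff.2 ⟨i, hi, hz⟩))
  · rintro (hz | hz)
    · exact ⟨{z}, mem_pieces.2 (Or.inl ⟨z, hz, rfl⟩), rfl⟩
    · obtain ⟨e, he, hz⟩ := Set.mem_iUnion₂.1 hz
      obtain ⟨i, hi, hz⟩ := (chain_spec he).1.mem_iff.1 hz
      exact ⟨_, mem_pieces.2 (Or.inr ⟨e, he, i, hi, rfl⟩), hz⟩

theorem isClosed_of_mem_pieces {A : Set Plane} (hA : A ∈ G.pieces) : IsClosed A := by
  rcases mem_pieces.1 hA with ⟨v, hv, rfl⟩ | ⟨e, he, i, hi, rfl⟩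
  · exact isClosed_singleton
  · exact isClosed_segment_plane _ _

variable (G) in
theorem isClosed_pointSet : IsClosed G.pointSet := by
  rw [← G.sUnion_pieces, Set.sUnion_eq_biUnion]
  exact G.finite_pieces.isClosed_biUnion fun A hA => isClosed_of_mem_pieces hA

variable (G) in
theorem dense_compl_pointSet : Dense G.pointSetᶜ := by
  rw [← G.sUnion_pieces, Set.compl_sUnion]
  refine dense_sInter_of_isOpen ?_ (G.finite_pieces.image _).countable ?_
  · rintro _ ⟨A, hA, rfl⟩
    exact (isClosed_of_mem_pieces hA).isOpen_compl
  · rintro _ ⟨A, hA, rfl⟩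
    rcases mem_pieces.1 hA with ⟨v, hv, rfl⟩ | ⟨e, he, i, hi, rfl⟩
    · exact dense_compl_singleton v
    · exact dense_compl_segment ((chain_spec he).1.2.1 i hi)

/-- The graph is a finite union of closed pieces, and the segment `[p, q]` is the only one through
`o`. So near `o` the graph coincides with a line. -/
theorem IsStraight.eventually_mem_pointSet_iff {e : Set Plane} (he : e ∈ G.edges) {p q o : Plane}
    (h : G.IsStraight e p q o) : ∀ᶠ z in 𝓝 o, (z ∈ G.pointSet ↔ orient p q z = 0) := by
  have hpq := h.ne he
  have h1 : ∀ A ∈ G.pieces, o ∈ A → A = segment ℝ p q := by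
    intro A hA ho
    rcases mem_pieces.1 hA with ⟨v, hv, rfl⟩ | ⟨e', he', i, hi, rfl⟩
    · rw [Set.mem_singleton_iff] at ho
      exact absurd (ho ▸ hv) (h.not_mem_verts he)
    · have hee := h.eq_of_mem he he' ((chain_spec he').1.mem_iff.2 ⟨i, hi, ho⟩)
      subst hee
      obtain ⟨j, hj, rfl, rfl, ho'⟩ := h
      rw [(chain_spec he).1.eq_of_mem_openSegment hj hi ho' ho]
  have h2 : ∀ᶠ z in 𝓝 o, ∀ A ∈ G.pieces, z ∈ A → A = segment ℝ p q := by
    rw [eventually_all_finite G.finite_pieces]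
    intro A hA
    by_cases hoA : o ∈ A
    · exact Eventually.of_forall fun z _ => h1 A hA hoA
    · filter_upwards [(isClosed_of_mem_pieces hA).isOpen_compl.mem_nhds hoA] with z hz hz'
      exact absurd hz' hz
  have h3 : ∀ᶠ z in 𝓝 o, orient p q z = 0 → z ∈ segment ℝ p q := by
    obtain ⟨i, -, -, -, ho⟩ := h
    exact eventually_mem_segment hpq ho
  filter_upwards [h2, h3] with z hz2 hz3
  constructor
  · intro hz
    rw [← G.sUnion_pieces] at hz
    obtain ⟨A, hA, hzA⟩ := hz
    exact orient_eq_zero_of_mem_segment (hz2 A hA hzA ▸ hzA)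
  · intro hz
    obtain ⟨i, hi, rfl, rfl, -⟩ := h
    exact Or.inr (Set.mem_biUnion he ((chain_spec he).1.mem_iff.2 ⟨i, hi, hz3 hz⟩))

theorem isStraight_or_mem_nodes {z : Plane} (hz : z ∈ G.pointSet) :
    (∃ e ∈ G.edges, ∃ p q, G.IsStraight e p q z) ∨
      z ∈ (G.verts : Set Plane) ∪ ⋃ e ∈ G.edges, (G.chain e).2 '' Set.Iic (G.chain e).1 := by
  rcases hz with hz | hz
  · exact Or.inr (Or.inl hz)
  · obtain ⟨e, he, hz⟩ := Set.mem_iUnion₂.1 hz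
    obtain ⟨i, hi, hz⟩ := (chain_spec he).1.mem_iff.1 hz
    rw [← insert_endpoints_openSegment] at hz
    rcases hz with rfl | rfl | hz
    · exact Or.inr (Or.inr (Set.mem_biUnion he ⟨i, hi.le, rfl⟩))
    · exact Or.inr (Or.inr (Set.mem_biUnion he ⟨i + 1, hi, rfl⟩))
    · exact Or.inl ⟨e, he, _, _, i, hi, rfl, rfl, hz⟩

theorem exists_isStraight {e : Set Plane} (he : e ∈ G.edges) : ∃ p q o, G.IsStraight e p q o := by
  obtain ⟨h1, -, -⟩ := chain_spec he
  exact ⟨_, _, midpoint ℝ ((G.chain e).2 0) ((G.chain e).2 1), 0, h1.1, rfl, rfl,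
    midpoint_mem_openSegment _ _⟩

/-! ### Faces -/

theorem face_eq {F : Set Plane} (hF : F ∈ G.faces) {z : Plane} (hz : z ∈ F) :
    F = connectedComponentIn G.pointSetᶜ z := by
  obtain ⟨w, hw, rfl⟩ := hF
  exact connectedComponentIn_eq hz

theorem face_eq_face {F F' : Set Plane} (hF : F ∈ G.faces) (hF' : F' ∈ G.faces) {z : Plane}
    (hz : z ∈ F) (hz' : z ∈ F') : F = F' := (face_eq hF hz).trans (face_eq hF' hz').symm

theorem isPreconnected_face {F : Set Plane} (hF : F ∈ G.faces) : IsPreconnected F := by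
  obtain ⟨w, hw, rfl⟩ := hF
  exact isPreconnected_connectedComponentIn

theorem face_subset {F : Set Plane} (hF : F ∈ G.faces) : F ⊆ G.pointSetᶜ := by
  obtain ⟨w, hw, rfl⟩ := hF
  exact connectedComponentIn_subset _ _

theorem isOpen_face {F : Set Plane} (hF : F ∈ G.faces) : IsOpen F := by
  obtain ⟨w, hw, rfl⟩ := hF
  exact G.isClosed_pointSet.isOpen_compl.connectedComponentIn

theorem face_nonempty {F : Set Plane} (hF : F ∈ G.faces) : F.Nonempty := by
  obtain ⟨w, hw, rfl⟩ := hF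
  exact ⟨w, mem_connectedComponentIn hw⟩

theorem mem_frontier_face_iff {F : Set Plane} (hF : F ∈ G.faces) {z : Plane} (hz : z ∈ G.pointSet) :
    z ∈ frontier F ↔ z ∈ closure F := by
  rw [(isOpen_face hF).frontier_eq]
  exact ⟨fun h => h.1, fun h => ⟨h, fun h' => face_subset hF h' hz⟩⟩

/-- In a small ball around `o` the graph is a line that `S` avoids. The part of `S` in that ball is
convex, hence within one face. Applied to the two open half-planes. -/
theorem exists_face_of_convex {e : Set Plane} (he : e ∈ G.edges) {p q o : Plane}
    (h : G.IsStraight e p q o) {S : Set Plane} (hS : Convex ℝ S) (hne : ∃ᶠ z in 𝓝 o, z ∈ S)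
    (hS0 : ∀ z ∈ S, orient p q z ≠ 0) : ∃ F ∈ G.faces, ∀ᶠ z in 𝓝 o, z ∈ S → z ∈ F := by
  obtain ⟨ε, hε, hball⟩ := Metric.eventually_nhds_iff_ball.1 (h.eventually_mem_pointSet_iff he)
  have hsub : Metric.ball o ε ∩ S ⊆ G.pointSetᶜ := fun z hz hz' =>
    hS0 z hz.2 ((hball z hz.1).1 hz')
  obtain ⟨w, hw⟩ := (hne.and_eventually (Metric.ball_mem_nhds o hε)).exists
  refine ⟨connectedComponentIn G.pointSetᶜ w, ⟨w, hsub ⟨hw.2, hw.1⟩, rfl⟩, ?_⟩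
  filter_upwards [Metric.ball_mem_nhds o hε] with z hz hz'
  exact ((convex_ball o ε).inter hS).isPreconnected.subset_connectedComponentIn ⟨hw.2, hw.1⟩ hsub
    ⟨hz, hz'⟩

theorem IsStraight.exists_faces {e : Set Plane} (he : e ∈ G.edges) {p q o : Plane}
    (h : G.IsStraight e p q o) : ∃ F₁ ∈ G.faces, ∃ F₂ ∈ G.faces,
      (∀ᶠ z in 𝓝 o, 0 < orient p q z → z ∈ F₁) ∧ (∀ᶠ z in 𝓝 o, orient p q z < 0 → z ∈ F₂) := by
  obtain ⟨F₁, h1, h1'⟩ := exists_face_of_convex he h (convex_orient_pos p q)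
    (frequently_orient_pos (h.ne he) h.orient_eq_zero) fun z hz => hz.ne'
  obtain ⟨F₂, h2, h2'⟩ := exists_face_of_convex he h (convex_orient_neg p q)
    (frequently_orient_neg (h.ne he) h.orient_eq_zero) fun z hz => hz.ne
  exact ⟨F₁, h1, F₂, h2, h1', h2'⟩

theorem parity_eq_of_mem_face {F : Set Plane} (hF : F ∈ G.faces) {v : G.verts}
    (c : G.graph.Walk v v) {z w : Plane} (hz : z ∈ F) (hw : w ∈ F) : parity c z = parity c w :=
  (isPreconnected_face hF).eq_of_eventually_eq (fun _ hx => eventually_parity_eq c fun hc =>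
    face_subset hF hx (walkPointSet_subset c hc)) hz hw

/-- The two faces at an edge. -/
structure IsFacePair (G : PlaneGraph) (x y : G.verts) (F₁ F₂ : Set Plane) : Prop where
  left_mem : F₁ ∈ G.faces
  right_mem : F₂ ∈ G.faces
  ne : F₁ ≠ F₂
  mem_edges_iff : ∀ F ∈ G.faces, ∀ (v : G.verts) (c : G.graph.Walk v v), G.Bounds c F →
    (s(x, y) ∈ c.edges ↔ F = F₁ ∨ F = F₂)
  eventually_mem : ∀ p q o, G.IsStraight (G.arc x y) p q o →
    ∀ᶠ z in 𝓝 o, z ∉ G.pointSet → z ∈ F₁ ∨ z ∈ F₂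
  arc_subset_left : G.arc x y ⊆ closure F₁
  arc_subset_right : G.arc x y ⊆ closure F₂
  parity_add : ∀ (v : G.verts) (c : G.graph.Walk v v), c.IsCycle → s(x, y) ∈ c.edges →
    ∀ z₁ ∈ F₁, ∀ z₂ ∈ F₂, parity c z₁ + parity c z₂ = 1

/-- The frontier of `F` is made of whole edges, so a single interior point decides whether the edge
belongs to it. -/
theorem Bounds.mem_edges_iff {F : Set Plane} (hF : F ∈ G.faces) {v : G.verts}
    {c : G.graph.Walk v v} (hc : G.Bounds c F) {x y : G.verts} (h : G.graph.Adj x y) {p q o : Plane}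
    (ho : G.IsStraight (G.arc x y) p q o) : s(x, y) ∈ c.edges ↔ o ∈ closure F := by
  rw [← ho.mem_walkPointSet_iff h, ← hc.2, mem_frontier_face_iff hF]
  exact arc_subset_pointSet h (ho.mem (arc_mem h))

/-- The two half-discs at one interior point of the edge give the faces. The bounding cycles then
carry this information along the whole edge. -/
theorem exists_isFacePair (hG : G.IsPentagulation) {x y : G.verts} (h : G.graph.Adj x y) :
    ∃ F₁ F₂, G.IsFacePair x y F₁ F₂ := by
  obtain ⟨p, q, o, ho⟩ := exists_isStraight (arc_mem h)
  obtain ⟨F₁, h1, F₂, h2, h1', h2'⟩ := ho.exists_faces (arc_mem h)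
  have hpos := frequently_orient_pos (ho.ne (arc_mem h)) ho.orient_eq_zero
  have hneg := frequently_orient_neg (ho.ne (arc_mem h)) ho.orient_eq_zero
  have hadd : ∀ (v : G.verts) (c : G.graph.Walk v v), c.IsCycle → s(x, y) ∈ c.edges →
      ∀ z₁ ∈ F₁, ∀ z₂ ∈ F₂, parity c z₁ + parity c z₂ = 1 := by
    intro v c hc hs z₁ hz₁ z₂ hz₂
    obtain ⟨K, hK⟩ := eventually_parity_of_isStraight h ho hc hs
    obtain ⟨w₁, hw₁, hw₁', hw₁''⟩ := (hpos.and_eventually (h1'.and hK)).exists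
    obtain ⟨w₂, hw₂, hw₂', hw₂''⟩ := (hneg.and_eventually (h2'.and hK)).exists
    rw [parity_eq_of_mem_face h1 c hz₁ (hw₁' hw₁), parity_eq_of_mem_face h2 c hz₂ (hw₂' hw₂),
      hw₁'' hw₁.ne', hw₂'' hw₂.ne, leftSide, leftSide, if_pos hw₁, if_neg (not_lt.2 hw₂.le)]
    linear_combination zmod_two_add_self K
  have hcl1 : o ∈ closure F₁ := mem_closure_iff_frequently.2
    ((hpos.and_eventually h1').mono fun z hz => hz.2 hz.1)
  have hcl2 : o ∈ closure F₂ := mem_closure_iff_frequently.2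
    ((hneg.and_eventually h2').mono fun z hz => hz.2 hz.1)
  have key : ∀ F ∈ G.faces, o ∈ closure F → F = F₁ ∨ F = F₂ := by
    intro F hF hcl
    obtain ⟨z, hz, hz1, hz2, hz3⟩ := ((mem_closure_iff_frequently.1 hcl).and_eventually
      (h1'.and (h2'.and (ho.eventually_mem_pointSet_iff (arc_mem h))))).exists
    have hne : orient p q z ≠ 0 := fun h0 => face_subset hF hz (hz3.2 h0)
    rcases lt_or_gt_of_ne hne with hlt | hgt
    · exact Or.inr (face_eq_face hF h2 hz (hz2 hlt))
    · exact Or.inl (face_eq_face hF h1 hz (hz1 hgt))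
  have hiff : ∀ F ∈ G.faces, ∀ (v : G.verts) (c : G.graph.Walk v v), G.Bounds c F →
      (s(x, y) ∈ c.edges ↔ F = F₁ ∨ F = F₂) := by
    intro F hF v c hc
    rw [hc.mem_edges_iff hF h ho]
    refine ⟨key F hF, ?_⟩
    rintro (rfl | rfl) <;> assumption
  have hsub : ∀ F ∈ G.faces, o ∈ closure F → G.arc x y ⊆ closure F := by
    intro F hF hcl
    obtain ⟨v, c, -, hc⟩ := hG F hF
    refine subset_trans (arc_subset_walkPointSet ((hc.mem_edges_iff hF h ho).2 hcl)) ?_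
    rw [← hc.2]
    exact frontier_subset_closure
  refine ⟨F₁, F₂, h1, h2, ?_, hiff, ?_, hsub F₁ h1 hcl1, hsub F₂ h2 hcl2, hadd⟩
  -- If the two faces coincided, the cycle bounding that face would have parity `a` there with `a +
  -- a = 1`.
  · rintro rfl
    obtain ⟨v, c, -, hc⟩ := hG F₁ h1
    obtain ⟨z, hz⟩ := face_nonempty h1
    have := hadd v c hc.1 ((hiff F₁ h1 v c hc).2 (Or.inl rfl)) z hz z hz
    rw [zmod_two_add_self] at this
    exact zero_ne_one this
  · intro p' q' o' ho'
    obtain ⟨E₁, g1, E₂, g2, g1', g2'⟩ := ho'.exists_faces (arc_mem h)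
    have hE : ∀ E ∈ G.faces, o' ∈ closure E → E = F₁ ∨ E = F₂ := by
      intro E hE hcl
      obtain ⟨v, c, -, hc⟩ := hG E hE
      exact (hiff E hE v c hc).1 ((hc.mem_edges_iff hE h ho').2 hcl)
    have hE1 := hE E₁ g1 (mem_closure_iff_frequently.2
      (((frequently_orient_pos (ho'.ne (arc_mem h)) ho'.orient_eq_zero).and_eventually g1').mono
        fun z hz => hz.2 hz.1))
    have hE2 := hE E₂ g2 (mem_closure_iff_frequently.2
      (((frequently_orient_neg (ho'.ne (arc_mem h)) ho'.orient_eq_zero).and_eventually g2').mono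
        fun z hz => hz.2 hz.1))
    filter_upwards [g1', g2', ho'.eventually_mem_pointSet_iff (arc_mem h)] with z hz1 hz2 hz3 hz
    rw [hz3] at hz
    rcases lt_or_gt_of_ne hz with hlt | hgt
    · have := hz2 hlt
      rcases hE2 with rfl | rfl
      · exact Or.inl this
      · exact Or.inr this
    · have := hz1 hgt
      rcases hE1 with rfl | rfl
      · exact Or.inl this
      · exact Or.inr this

end PlaneGraph

/-! ### Jumps across edges, and connectedness of the sides of a cycle. -/

theorem zmod_two_cases (a : ZMod 2) : a = 0 ∨ a = 1 := by
  revert a; decide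

theorem List.IsChain.exists_forall_eq {α β : Type*} [Inhabited β] {R : α → α → Prop} {f : α → β}
    {L : List α} (hL : L.IsChain R) (h : ∀ a ∈ L, ∀ b ∈ L, R a b → f a = f b) :
    ∃ k, ∀ a ∈ L, f a = k := by
  induction L with
  | nil => exact ⟨default, by simp⟩
  | cons a L ih =>
    cases L with
    | nil => exact ⟨f a, by simp⟩
    | cons b L =>
      rw [List.isChain_cons_cons] at hL
      obtain ⟨k, hk⟩ := ih hL.2 fun x hx y hy =>
        h x (List.mem_cons_of_mem _ hx) y (List.mem_cons_of_mem _ hy)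
      refine ⟨k, fun x hx => ?_⟩
      rcases List.mem_cons.1 hx with rfl | hx
      · rw [h x (by simp) b (by simp) hL.1]
        exact hk b (by simp)
      · exact hk x hx

namespace SimpleGraph.Walk

variable {V : Type*} {H : SimpleGraph V} {v : V} {c : H.Walk v v}

theorem IsCycle.ncard_mem_edges (hc : c.IsCycle) {u : V} (hu : u ∈ c.support) :
    {y | s(u, y) ∈ c.edges}.ncard = 2 := by
  rw [← hc.ncard_neighborSet_toSubgraph_eq_two hu]
  congr 1
  ext y
  exact adj_toSubgraph_iff_mem_edges.symm

theorem IsCycle.exists_mem_edges (hc : c.IsCycle) {u : V} (hu : u ∈ c.support) :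
    ∃ y, s(u, y) ∈ c.edges := by
  have h := hc.ncard_mem_edges hu
  have : {y | s(u, y) ∈ c.edges}.Nonempty := Set.nonempty_of_ncard_ne_zero (by rw [h]; norm_num)
  exact this

theorem IsCycle.exists_ne_mem_edges (hc : c.IsCycle) {u v : V} (hu : s(u, v) ∈ c.edges) :
    ∃ y, y ≠ v ∧ s(u, y) ∈ c.edges := by
  have h := hc.ncard_mem_edges (c.fst_mem_support_of_mem_edges hu)
  obtain ⟨a, b, hab, he⟩ := Set.ncard_eq_two.1 h
  have ha : a ∈ {y | s(u, y) ∈ c.edges} := by rw [he]; simp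
  have hb : b ∈ {y | s(u, y) ∈ c.edges} := by rw [he]; simp
  by_cases hav : a = v
  · exact ⟨b, fun hbv => hab (hav.trans hbv.symm), hb⟩
  · exact ⟨a, hav, ha⟩

theorem IsCycle.even_card_filter [Fintype V] [DecidableEq V] (hc : c.IsCycle) (u : V) :
    Even (Finset.univ.filter fun y => s(u, y) ∈ c.edges).card := by
  by_cases hu : u ∈ c.support
  · have h := hc.ncard_mem_edges hu
    rw [← Set.ncard_coe_finset, Finset.coe_filter]
    simp [h]
  · rw [Finset.card_eq_zero.2]
    · exact Even.zero
    · ext y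
      simp only [Finset.mem_filter, Finset.mem_univ, true_and, Finset.notMem_empty, iff_false]
      exact fun h => hu (c.fst_mem_support_of_mem_edges h)

end SimpleGraph.Walk

namespace PlaneGraph

variable {G : PlaneGraph}

theorem IsFacePair.symm {x y : G.verts} {F₁ F₂ : Set Plane} (h : G.graph.Adj x y)
    (hF : G.IsFacePair x y F₁ F₂) : G.IsFacePair y x F₁ F₂ where
  left_mem := hF.left_mem
  right_mem := hF.right_mem
  ne := hF.ne
  mem_edges_iff := by rw [Sym2.eq_swap]; exact hF.mem_edges_iff
  eventually_mem := by rw [arc_comm h]; exact hF.eventually_mem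
  arc_subset_left := by rw [arc_comm h]; exact hF.arc_subset_left
  arc_subset_right := by rw [arc_comm h]; exact hF.arc_subset_right
  parity_add := by rw [Sym2.eq_swap]; exact hF.parity_add

theorem IsFacePair.eq_or_eq (hG : G.IsPentagulation) {x y : G.verts} {F₁ F₂ E : Set Plane}
    (hF : G.IsFacePair x y F₁ F₂) {E' : Set Plane} (hE : G.IsFacePair x y E E') :
    E = F₁ ∨ E = F₂ := by
  obtain ⟨v, c, -, hc⟩ := hG E hE.left_mem
  exact (hF.mem_edges_iff E hE.left_mem v c hc).1
    ((hE.mem_edges_iff E hE.left_mem v c hc).2 (Or.inl rfl))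

theorem IsFacePair.swap {x y : G.verts} {F₁ F₂ : Set Plane}
    (hF : G.IsFacePair x y F₁ F₂) : G.IsFacePair x y F₂ F₁ where
  left_mem := hF.right_mem
  right_mem := hF.left_mem
  ne := hF.ne.symm
  mem_edges_iff F h v c hc := by rw [hF.mem_edges_iff F h v c hc, or_comm]
  eventually_mem p q o ho := by simpa only [or_comm] using hF.eventually_mem p q o ho
  arc_subset_left := hF.arc_subset_right
  arc_subset_right := hF.arc_subset_left
  parity_add v c hc hs z₁ h₁ z₂ h₂ := by rw [add_comm]; exact hF.parity_add v c hc hs z₂ h₂ z₁ h₁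

/-- The pair of faces at an edge is determined up to order, so the jump of `σ` across the edge does
not depend on the choice. -/
theorem IsFacePair.add_eq (hG : G.IsPentagulation) {x y : G.verts} {F₁ F₂ E₁ E₂ : Set Plane}
    (hF : G.IsFacePair x y F₁ F₂) (hE : G.IsFacePair x y E₁ E₂) (σ : Set Plane → ZMod 2) :
    σ F₁ + σ F₂ = σ E₁ + σ E₂ := by
  rcases hF.eq_or_eq hG hE with h1 | h1 <;> rcases hF.eq_or_eq hG hE.swap with h2 | h2
  · exact absurd (h1.trans h2.symm) hE.ne
  · rw [h1, h2]
  · rw [h1, h2, add_comm]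
  · exact absurd (h1.trans h2.symm) hE.ne

/-- The boundary of a set of faces is even at every vertex. -/
theorem sum_facePair_eq_zero (hG : G.IsPentagulation) (u : G.verts) (σ : Set Plane → ZMod 2)
    {A B : G.verts → Set Plane} {N : Finset G.verts} (hN : ∀ y, y ∈ N ↔ G.graph.Adj u y)
    (hAB : ∀ y ∈ N, G.IsFacePair u y (A y) (B y)) : ∑ y ∈ N, (σ (A y) + σ (B y)) = 0 := by
  classical
  have h1 : ∀ y ∈ N, σ (A y) + σ (B y) =
      ∑ F ∈ N.image A ∪ N.image B, if F = A y ∨ F = B y then σ F else 0 := by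
    intro y hy
    rw [← Finset.sum_filter]
    have : (N.image A ∪ N.image B).filter (fun F => F = A y ∨ F = B y) = {A y, B y} := by
      ext F
      simp only [Finset.mem_filter, Finset.mem_union, Finset.mem_image, Finset.mem_insert,
        Finset.mem_singleton, and_iff_right_iff_imp]
      rintro (rfl | rfl)
      · exact Or.inl ⟨y, hy, rfl⟩
      · exact Or.inr ⟨y, hy, rfl⟩
    rw [this, Finset.sum_pair (hAB y hy).ne]
  rw [Finset.sum_congr rfl h1, Finset.sum_comm]
  -- After exchanging the sums, each face is counted once for every edge of its bounding cycle at
  -- `u`, an even number.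
  refine Finset.sum_eq_zero fun F hF => ?_
  have hFf : F ∈ G.faces := by
    rcases Finset.mem_union.1 hF with h | h <;> obtain ⟨y, hy, rfl⟩ := Finset.mem_image.1 h
    · exact (hAB y hy).left_mem
    · exact (hAB y hy).right_mem
  obtain ⟨v, c, -, hc⟩ := hG F hFf
  rw [← Finset.sum_filter, Finset.sum_const]
  have h2 : N.filter (fun y => F = A y ∨ F = B y) =
      Finset.univ.filter fun y => s(u, y) ∈ c.edges := by
    ext y
    simp only [Finset.mem_filter, Finset.mem_univ, true_and]
    constructor
    · rintro ⟨hy, h⟩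
      exact ((hAB y hy).mem_edges_iff F hFf v c hc).2 h
    · intro h
      have hy := (hN y).2 (c.adj_of_mem_edges h)
      exact ⟨hy, ((hAB y hy).mem_edges_iff F hFf v c hc).1 h⟩
  obtain ⟨k, hk⟩ := hc.1.even_card_filter u
  rw [h2, hk, add_smul, zmod_two_add_self]

/-- A function on the faces which agrees on the two faces at each edge is constant. -/
theorem exists_eq_of_forall_facePair {s : Plane → ZMod 2}
    (hs : ∀ z ∉ G.pointSet, ∀ᶠ w in 𝓝 z, s w = s z)
    (h : ∀ x y, G.graph.Adj x y → ∃ A B, G.IsFacePair x y A B ∧ ∀ z ∈ A, ∀ w ∈ B, s z = s w) :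
    ∃ k, ∀ z ∉ G.pointSet, s z = k := by
  set N : Set Plane := (G.verts : Set Plane) ∪ ⋃ e ∈ G.edges, (G.chain e).2 '' Set.Iic (G.chain e).1
    with hN
  have hNfin : N.Finite := (G.verts.finite_toSet).union
    (G.edges.finite_toSet.biUnion fun e _ => (Set.finite_Iic _).image _)
  have hNsub : N ⊆ G.pointSet := by
    rintro z (hz | hz)
    · exact Or.inl hz
    · obtain ⟨e, he, i, hi, rfl⟩ := Set.mem_iUnion₂.1 hz
      exact Or.inr (Set.mem_biUnion he ((chain_spec he).1.node_mem hi))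
  -- Removing the finitely many vertices and bends leaves the plane connected. It remains to extend
  -- `s` over the open segments to a locally constant function `t`.
  have hconn : IsPreconnected Nᶜ := by
    refine (hNfin.countable.isPathConnected_compl_of_one_lt_rank ?_).isConnected.isPreconnected
    rw [← Module.finrank_eq_rank]
    simp
  have hfreq : ∀ z : Plane, ∃ᶠ w in 𝓝 z, w ∉ G.pointSet := fun z =>
    mem_closure_iff_frequently.1 (G.dense_compl_pointSet z)
  have hex : ∀ z, ∃ k, z ∈ Nᶜ → ∀ᶠ w in 𝓝 z, w ∉ G.pointSet → s w = k := by
    intro z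
    by_cases hz : z ∈ G.pointSet
    · rcases isStraight_or_mem_nodes hz with ⟨e, he, p, q, hst⟩ | hz'
      · obtain ⟨x, y, hadj, rfl⟩ := exists_eq_arc he
        obtain ⟨A, B, hAB, heq⟩ := h x y hadj
        obtain ⟨a, ha⟩ := face_nonempty hAB.left_mem
        obtain ⟨b, hb⟩ := face_nonempty hAB.right_mem
        refine ⟨s a, fun _ => (hAB.eventually_mem p q z hst).mono fun w hw hwp => ?_⟩
        rcases hw hwp with hw | hw
        · rw [heq a ha b hb, heq w hw b hb]
        · exact (heq a ha w hw).symm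
      · exact ⟨0, fun h => absurd hz' h⟩
    · exact ⟨s z, fun _ => (hs z hz).mono fun w hw _ => hw⟩
  choose t ht using hex
  have huniq : ∀ z ∈ Nᶜ, ∀ k, (∀ᶠ w in 𝓝 z, w ∉ G.pointSet → s w = k) → t z = k := by
    intro z hz k hk
    obtain ⟨w, hw, h1, h2⟩ := ((hfreq z).and_eventually ((ht z hz).and hk)).exists
    rw [← h1 hw, h2 hw]
  have htloc : ∀ z ∈ Nᶜ, ∀ᶠ w in 𝓝 z, t w = t z := by
    intro z hz
    filter_upwards [eventually_eventually_nhds.2 (ht z hz),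
      hNfin.isClosed.isOpen_compl.mem_nhds hz] with w hw hw'
    exact huniq w hw' _ hw
  obtain ⟨z₀, hz₀⟩ := (hfreq 0).exists
  have hts : ∀ z ∉ G.pointSet, t z = s z := fun z hz =>
    huniq z (fun h => hz (hNsub h)) _ ((hs z hz).mono fun w hw _ => hw)
  refine ⟨s z₀, fun z hz => ?_⟩
  rw [← hts z hz, ← hts z₀ hz₀]
  exact hconn.eq_of_eventually_eq htloc (fun h => hz (hNsub h)) (fun h => hz₀ (hNsub h))

/-- Up to constants, the crossing parity of a cycle is the only nonconstant function which is
locally constant off the cycle: each side of the cycle is connected. -/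
theorem exists_eq_or_eq_parity_add (hG : G.IsPentagulation) {v : G.verts} {c : G.graph.Walk v v}
    (hc : c.IsCycle) {s : Plane → ZMod 2}
    (hs : ∀ z ∉ G.walkPointSet c, ∀ᶠ w in 𝓝 z, s w = s z) :
    ∃ k, (∀ z ∉ G.pointSet, s z = k) ∨ ∀ z ∉ G.pointSet, s z = parity c z + k := by
  classical
  have hpair : ∀ x y, ∃ A B, G.graph.Adj x y → G.IsFacePair x y A B := by
    intro x y
    by_cases h : G.graph.Adj x y
    · obtain ⟨A, B, hAB⟩ := exists_isFacePair hG h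
      exact ⟨A, B, fun _ => hAB⟩
    · exact ⟨∅, ∅, fun h' => absurd h' h⟩
  choose A B hAB using hpair
  have hoff : ∀ {z}, z ∉ G.pointSet → z ∉ G.walkPointSet c := fun hz hz' =>
    hz (walkPointSet_subset c hz')
  have hs' : ∀ z ∉ G.pointSet, ∀ᶠ w in 𝓝 z, s w = s z := fun z hz => hs z (hoff hz)
  -- The constant value of `s` on a face; the default for the empty set never matters.
  let σ : Set Plane → ZMod 2 := fun F => if h : F.Nonempty then s h.some else 0
  have hσ : ∀ F ∈ G.faces, ∀ z ∈ F, s z = σ F := by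
    intro F hF z hz
    have hne := face_nonempty hF
    simp only [σ, dif_pos hne]
    exact (isPreconnected_face hF).eq_of_eventually_eq (fun w hw => hs' w (face_subset hF hw)) hz
      hne.some_mem
  have hzero : ∀ x y, G.graph.Adj x y → s(x, y) ∉ c.edges → σ (A x y) + σ (B x y) = 0 := by
    intro x y h hxy
    obtain ⟨p, q, o, ho⟩ := exists_isStraight (arc_mem h)
    have hP := hAB x y h
    have hoc : o ∉ G.walkPointSet c := fun hoc => hxy ((ho.mem_walkPointSet_iff h).1 hoc)
    have hval : ∀ F ∈ G.faces, o ∈ closure F → σ F = s o := by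
      intro F hF hcl
      obtain ⟨w, hw, hw'⟩ := ((mem_closure_iff_frequently.1 hcl).and_eventually (hs o hoc)).exists
      rw [← hσ F hF w hw, hw']
    rw [hval _ hP.left_mem (hP.arc_subset_left (ho.mem (arc_mem h))),
      hval _ hP.right_mem (hP.arc_subset_right (ho.mem (arc_mem h))), zmod_two_add_self]
  -- At the common vertex all jumps sum to zero, and those off the cycle vanish. So the two cycle
  -- edges there have equal jumps.
  have hcons : ∀ d ∈ c.darts, ∀ d' ∈ c.darts, G.graph.DartAdj d d' →
      σ (A d.fst d.snd) + σ (B d.fst d.snd) = σ (A d'.fst d'.snd) + σ (B d'.fst d'.snd) := by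
    intro d hd d' hd' hdd
    obtain ⟨u, hu⟩ : ∃ u, u = d.snd := ⟨_, rfl⟩
    have hu' : d'.fst = u := by rw [hu]; exact hdd.symm
    have had : G.graph.Adj u d.fst := by rw [hu]; exact d.adj.symm
    have had' : G.graph.Adj u d'.snd := by rw [← hu']; exact d'.adj
    have he : s(u, d.fst) ∈ c.edges := by
      rw [hu, Sym2.eq_swap]; exact List.mem_map_of_mem (f := SimpleGraph.Dart.edge) hd
    have he' : s(u, d'.snd) ∈ c.edges := by
      rw [← hu']; exact List.mem_map_of_mem (f := SimpleGraph.Dart.edge) hd'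
    rw [← hu, hu', (hAB d.fst u (had.symm)).add_eq hG ((hAB u d.fst had).symm had) σ]
    by_cases hne : d.fst = d'.snd
    · rw [hne]
    have hset : {y | s(u, y) ∈ c.edges} = {d.fst, d'.snd} := by
      refine (Set.eq_of_subset_of_ncard_le ?_ ?_ (Set.toFinite _)).symm
      · rintro y (rfl | rfl)
        · exact he
        · exact he'
      · rw [hc.ncard_mem_edges (c.fst_mem_support_of_mem_edges he), Set.ncard_pair hne]
    have hsum := sum_facePair_eq_zero hG u σ (A := A u) (B := B u)
      (N := Finset.univ.filter fun y => G.graph.Adj u y) (by simp)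
      (fun y hy => hAB u y (Finset.mem_filter.1 hy).2)
    rw [← Finset.sum_subset (s₁ := {d.fst, d'.snd}), Finset.sum_pair hne] at hsum
    · linear_combination hsum - zmod_two_add_self (σ (A u d'.snd) + σ (B u d'.snd))
    · intro y hy
      rcases Finset.mem_insert.1 hy with rfl | hy
      · simpa using had
      · rw [Finset.mem_singleton] at hy
        subst hy
        simpa using had'
    · intro y hy hy'
      refine hzero u y (Finset.mem_filter.1 hy).2 fun hmem => hy' ?_
      have : y ∈ ({d.fst, d'.snd} : Set _) := hset ▸ hmem
      simpa using this
  obtain ⟨k, hk⟩ := c.isChain_dartAdj_darts.exists_forall_eq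
    (f := fun d => σ (A d.fst d.snd) + σ (B d.fst d.snd)) hcons
  have hk' : ∀ x y, s(x, y) ∈ c.edges → σ (A x y) + σ (B x y) = k := by
    intro x y hxy
    obtain ⟨d, hd, hde⟩ := List.mem_map.1 (show s(x, y) ∈ c.darts.map SimpleGraph.Dart.edge from hxy)
    rw [← hk d hd]
    have hadj := c.adj_of_mem_edges hxy
    rcases Sym2.eq_iff.1 (show s(d.fst, d.snd) = s(x, y) from hde) with ⟨h1, h2⟩ | ⟨h1, h2⟩
    · rw [h1, h2]
    · rw [h1, h2]
      exact (hAB x y hadj).add_eq hG ((hAB y x hadj.symm).symm hadj.symm) σ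
  have key : ∀ a b : ZMod 2, a + b = 0 → a = b := by decide
  -- Common jump 0: `s` itself has no jumps. Common jump 1: adding the parity of `c` cancels them
  -- all.
  rcases zmod_two_cases k with rfl | rfl
  · obtain ⟨k, hk⟩ := exists_eq_of_forall_facePair hs' (fun x y h => ⟨A x y, B x y, hAB x y h, by
      intro z hz w hw
      rw [hσ _ (hAB x y h).left_mem z hz, hσ _ (hAB x y h).right_mem w hw]
      by_cases hxy : s(x, y) ∈ c.edges
      · exact key _ _ (hk' x y hxy)
      · exact key _ _ (hzero x y h hxy)⟩)
    exact ⟨k, Or.inl hk⟩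
  · obtain ⟨k, hk⟩ := exists_eq_of_forall_facePair (G := G) (s := fun z => s z + parity c z)
      (fun z hz => by
        filter_upwards [hs' z hz, eventually_parity_eq c (hoff hz)] with w h1 h2
        rw [h1, h2]) (fun x y h => ⟨A x y, B x y, hAB x y h, by
      intro z hz w hw
      refine key _ _ ?_
      rw [hσ _ (hAB x y h).left_mem z hz, hσ _ (hAB x y h).right_mem w hw]
      by_cases hxy : s(x, y) ∈ c.edges
      · have h1 := hk' x y hxy
        have h2 := (hAB x y h).parity_add v c hc hxy z hz w hw
        linear_combination h1 + h2 + zmod_two_add_self 1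
      · have h1 := hzero x y h hxy
        obtain ⟨p, q, o, ho⟩ := exists_isStraight (arc_mem h)
        have hoc : o ∉ G.walkPointSet c := fun hoc => hxy ((ho.mem_walkPointSet_iff h).1 hoc)
        have hval : ∀ F ∈ G.faces, o ∈ closure F → ∀ z ∈ F, parity c z = parity c o := by
          intro F hF hcl z hz
          obtain ⟨w, hw, hw'⟩ := ((mem_closure_iff_frequently.1 hcl).and_eventually
            (eventually_parity_eq c hoc)).exists
          rw [parity_eq_of_mem_face hF c hz hw, hw']
        rw [hval _ (hAB x y h).left_mem ((hAB x y h).arc_subset_left (ho.mem (arc_mem h))) z hz,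
          hval _ (hAB x y h).right_mem ((hAB x y h).arc_subset_right (ho.mem (arc_mem h))) w hw]
        linear_combination h1 + zmod_two_add_self (parity c o)⟩)
    refine ⟨k, Or.inr fun z hz => ?_⟩
    rw [← hk z hz]
    linear_combination -zmod_two_add_self (parity c z)

end PlaneGraph

/-! ### Vertices on the sides of a cycle, and nested cycles. -/

namespace PlaneGraph

variable {G : PlaneGraph}

/-- The vertex `w` lies on the side `τ` of the closed walk `c`. -/
def OnSide {v : G.verts} (c : G.graph.Walk v v) (τ : ZMod 2) (w : G.verts) : Prop :=
  w ∉ c.support ∧ parity c w = τ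

/-- The parities on the two faces at the edge sum to 1, so each value is taken on one of them. -/
theorem exists_face_of_mem_edges (hG : G.IsPentagulation) {v x y : G.verts} {c : G.graph.Walk v v}
    (hc : c.IsCycle) (hs : s(x, y) ∈ c.edges) (τ : ZMod 2) :
    ∃ F ∈ G.faces, G.arc x y ⊆ closure F ∧ ∀ z ∈ F, parity c z = τ := by
  obtain ⟨F₁, F₂, hF⟩ := exists_isFacePair hG (c.adj_of_mem_edges hs)
  obtain ⟨z₁, hz₁⟩ := face_nonempty hF.left_mem
  obtain ⟨z₂, hz₂⟩ := face_nonempty hF.right_mem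
  have h := hF.parity_add v c hc hs z₁ hz₁ z₂ hz₂
  have key : ∀ a b t : ZMod 2, a + b = 1 → a = t ∨ b = t := by decide
  rcases key _ _ τ h with h1 | h1
  · exact ⟨F₁, hF.left_mem, hF.arc_subset_left, fun z hz =>
      (parity_eq_of_mem_face hF.left_mem c hz hz₁).trans h1⟩
  · exact ⟨F₂, hF.right_mem, hF.arc_subset_right, fun z hz =>
      (parity_eq_of_mem_face hF.right_mem c hz hz₂).trans h1⟩

theorem mem_walkPointSet_of_isCycle {v : G.verts} {c : G.graph.Walk v v} (hc : c.IsCycle)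
    {z : Plane} : z ∈ G.walkPointSet c ↔ ∃ x y, s(x, y) ∈ c.edges ∧ z ∈ G.arc x y := by
  constructor
  · intro hz
    rcases mem_walkPointSet.1 hz with ⟨w, hw, rfl⟩ | ⟨x, y, -, hs, hz⟩
    · obtain ⟨y, hy⟩ := hc.exists_mem_edges hw
      exact ⟨w, y, hy, (isPolygonalArc_arc (c.adj_of_mem_edges hy)).left_mem⟩
    · exact ⟨x, y, hs, hz⟩
  · rintro ⟨x, y, hs, hz⟩
    exact arc_subset_walkPointSet hs hz

theorem notMem_walkPointSet_of_mem_arc {v x y : G.verts} {c : G.graph.Walk v v}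
    (h : G.graph.Adj x y) (hx : x ∉ c.support) {z : Plane} (hz : z ∈ G.arc x y)
    (hzy : z ≠ y) : z ∉ G.walkPointSet c := by
  intro hzc
  rcases mem_walkPointSet.1 hzc with ⟨w, hw, rfl⟩ | ⟨x', y', hadj, hs, hz'⟩
  · rcases eq_or_eq_of_mem_arc h hz with rfl | rfl
    · exact hx hw
    · exact hzy rfl
  · have hne : G.arc x y ≠ G.arc x' y' := by
      intro he
      rw [← (arc_eq_arc_iff h hadj).1 he] at hs
      exact hx (c.fst_mem_support_of_mem_edges hs)
    have hdis := G.disjoint_edges _ (arc_mem h) _ (arc_mem hadj) hne x x.2 y y.2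
      (isPolygonalArc_arc h)
    by_cases hzx : z = x
    · rw [hzx] at hz'
      rcases eq_or_eq_of_mem_arc hadj hz' with rfl | rfl
      · exact hx (c.fst_mem_support_of_mem_edges hs)
      · exact hx (c.snd_mem_support_of_mem_edges hs)
    · exact Set.disjoint_left.1 hdis ⟨hz, by simp [hzx, hzy]⟩ hz'

/-- Followed from `x`, the arc can meet `c` only at `y`, so parity stays constant segment by segment
until then. -/
theorem parity_eq_of_mem_arc {v x y : G.verts} (c : G.graph.Walk v v)
    (h : G.graph.Adj x y) (hx : x ∉ c.support) {z : Plane} (hz : z ∈ G.arc x y)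
    (hzy : z ≠ y) : parity c z = parity c x := by
  obtain ⟨n, p, hp, hp0, hpn⟩ := isPolygonalArc_iff.1 (isPolygonalArc_arc h)
  have hmove : ∀ i < n, ∀ w ∈ segment ℝ (p i) (p (i + 1)), w ≠ y → parity c w = parity c (p i) := by
    intro i hi w hw hwy
    have hsub : segment ℝ (p i) w ⊆ segment ℝ (p i) (p (i + 1)) :=
      (convex_segment _ _).segment_subset (left_mem_segment ℝ _ _) hw
    refine (convex_segment (p i) w).isPreconnected.eq_of_eventually_eq (fun a ha =>
      eventually_parity_eq c (notMem_walkPointSet_of_mem_arc h hx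
        (hp.mem_iff.2 ⟨i, hi, hsub ha⟩) ?_)) (right_mem_segment ℝ _ _) (left_mem_segment ℝ _ _)
    rintro rfl
    have hin : i + 1 = n := by
      by_contra hne
      have hn1 : n - 1 + 1 = n := by omega
      have := hp.2.2.1 i (n - 1) (by omega) (by omega) (y : Plane) (hsub ha)
        (by rw [hn1, hpn]; exact right_mem_segment ℝ _ _)
      apply hp.2.1 (n - 1) (by omega)
      rw [hn1, hpn, this.2]
    rw [hin, hpn] at hw
    -- On the last segment, `w` and `y` would each lie between `p i` and the other, which forces `w
    -- = y`.
    exact hwy ((wbtw_swap_right_iff ℝ (p i)).1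
      ⟨mem_segment_iff_wbtw.1 hw, mem_segment_iff_wbtw.1 ha⟩)
  have hnode : ∀ i < n, parity c (p i) = parity c x := by
    intro i
    induction i with
    | zero => intro _; rw [hp0]
    | succ i ih =>
      intro hi
      rw [← ih (by omega)]
      refine hmove i (by omega) _ (right_mem_segment ℝ _ _) ?_
      rw [← hpn]
      intro he
      have hn1 : n - 1 + 1 = n := by omega
      have h1 : p n ∈ segment ℝ (p (n - 1)) (p (n - 1 + 1)) := by
        rw [hn1]; exact right_mem_segment ℝ _ _
      rcases Nat.lt_or_ge (i + 1) (n - 1) with h2 | h2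
      · have h3 := (hp.2.2.1 (i + 1) (n - 1) h2 (by omega) (p n)
          (by rw [← he]; exact left_mem_segment ℝ _ _) h1).2
        apply hp.2.1 (n - 1) (by omega)
        rw [hn1, ← h3]
      · have h3 : i + 1 = n - 1 := by omega
        apply hp.2.1 (i + 1) hi
        rw [he, h3, hn1]
  obtain ⟨i, hi, hzi⟩ := hp.mem_iff.1 hz
  rw [hmove i hi z hzi hzy, hnode i hi]

theorem parity_eq_of_adj {v x y : G.verts} (c : G.graph.Walk v v)
    (h : G.graph.Adj x y) (hx : x ∉ c.support) (hy : y ∉ c.support) : parity c x = parity c y := by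
  obtain ⟨p, q, o, ho⟩ := exists_isStraight (arc_mem h)
  have hv := ho.not_mem_verts (arc_mem h)
  have hmem := ho.mem (arc_mem h)
  rw [← parity_eq_of_mem_arc c h hx hmem (by rintro rfl; exact hv y.2),
    ← parity_eq_of_mem_arc c h.symm hy (by rwa [arc_comm h]) (by rintro rfl; exact hv x.2)]

/-- A cycle in a closed side of another cycle has a side contained in that side. -/
theorem exists_side_subset (hG : G.IsPentagulation) {v v' : G.verts} {c : G.graph.Walk v v}
    {c' : G.graph.Walk v' v'} (hc : c.IsCycle) (hc' : c'.IsCycle) {τ : ZMod 2}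
    (h : ∀ x y, s(x, y) ∈ c'.edges → s(x, y) ∈ c.edges ∨ OnSide c τ x ∨ OnSide c τ y) :
    ∃ τ', ∀ w, OnSide c' τ' w → OnSide c τ w := by
  classical
  have hpart : ∀ x y, G.graph.Adj x y → OnSide c τ x → ∀ z ∈ G.arc x y,
      z ∈ G.walkPointSet c ∨ parity c z = τ := by
    intro x y hadj hx z hz
    by_cases hzy : z = y
    · by_cases hy : y ∈ c.support
      · exact Or.inl (hzy ▸ coe_mem_walkPointSet.2 hy)
      · rw [hzy, ← parity_eq_of_adj c hadj hx.1 hy]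
        exact Or.inr hx.2
    · rw [parity_eq_of_mem_arc c hadj hx.1 hz hzy]
      exact Or.inr hx.2
  have hsub : ∀ z ∈ G.walkPointSet c', z ∈ G.walkPointSet c ∨ parity c z = τ := by
    intro z hz
    obtain ⟨x, y, hs, hz⟩ := (mem_walkPointSet_of_isCycle hc').1 hz
    have hadj := c'.adj_of_mem_edges hs
    rcases h x y hs with h1 | h1 | h1
    · exact Or.inl (arc_subset_walkPointSet h1 hz)
    · exact hpart x y hadj h1 z hz
    · exact hpart y x hadj.symm h1 z (by rwa [arc_comm hadj])
  obtain ⟨y, hy⟩ := hc.exists_mem_edges c.start_mem_support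
  have hoff : ∀ {z}, z ∉ G.pointSet → z ∉ G.walkPointSet c := fun hz hz' =>
    hz (walkPointSet_subset c hz')
  have key : ∀ a t : ZMod 2, a ≠ t → a = t + 1 := by decide
  -- The other side of `c` is disjoint from `c'`. Replacing the parity of `c'` by 0 on side `τ`
  -- gives a function locally constant off `c`, to which `exists_eq_or_eq_parity_add` applies.
  have hconst : ∃ κ, ∀ z ∉ G.pointSet, parity c z ≠ τ → parity c' z = κ := by
    obtain ⟨F, hF, -, hFτ⟩ := exists_face_of_mem_edges hG hc hy τ
    obtain ⟨w, hw⟩ := face_nonempty hF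
    obtain ⟨k, hk⟩ := exists_eq_or_eq_parity_add hG hc
      (s := fun z => if parity c z = τ then 0 else parity c' z) (by
        intro z hz
        by_cases hzτ : parity c z = τ
        · filter_upwards [eventually_parity_eq c hz] with w hw
          rw [if_pos hzτ, if_pos (hw.trans hzτ)]
        · have hz' : z ∉ G.walkPointSet c' := fun hz' => (hsub z hz').elim hz hzτ
          filter_upwards [eventually_parity_eq c hz, eventually_parity_eq c' hz'] with w hw hw'
          rw [if_neg hzτ, if_neg (hw.symm ▸ hzτ), hw'])
    rcases hk with hk | hk
    · refine ⟨k, fun z hz hzτ => ?_⟩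
      rw [← hk z hz, if_neg hzτ]
    · refine ⟨τ + 1 + k, fun z hz hzτ => ?_⟩
      have := hk z hz
      rw [if_neg hzτ] at this
      rw [this, key _ _ hzτ]
  obtain ⟨κ, hκ⟩ := hconst
  refine ⟨κ + 1, fun w hw => ?_⟩
  have hsucc : ∀ a : ZMod 2, a ≠ a + 1 := by decide
  have hne := hsucc κ
  have hw' : (w : Plane) ∉ G.walkPointSet c' := fun h => hw.1 (coe_mem_walkPointSet.1 h)
  -- A vertex of `c` off `c'` is a limit of points of a face on the far side of `c`, so its
  -- `c'`-parity is `κ`, not `κ + 1`.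
  by_cases hwc : (w : Plane) ∈ G.walkPointSet c
  · obtain ⟨x, y, hs, hz⟩ := (mem_walkPointSet_of_isCycle hc).1 hwc
    obtain ⟨F, hF, hcl, hFτ⟩ := exists_face_of_mem_edges hG hc hs (τ + 1)
    obtain ⟨z, hz, hzp⟩ := ((mem_closure_iff_frequently.1 (hcl hz)).and_eventually
      (eventually_parity_eq c' hw')).exists
    refine absurd ?_ hne
    rw [← hw.2, ← hzp, hκ z (face_subset hF hz)]
    rw [hFτ z hz]
    exact (hsucc τ).symm
  · refine ⟨fun h => hwc (coe_mem_walkPointSet.2 h), ?_⟩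
    by_contra hwτ
    obtain ⟨z, hz, hz1, hz2⟩ := ((mem_closure_iff_frequently.1
      (G.dense_compl_pointSet (w : Plane))).and_eventually
      ((eventually_parity_eq c hwc).and (eventually_parity_eq c' hw'))).exists
    refine absurd ?_ hne
    rw [← hw.2, ← hz2, hκ z hz (hz1.symm ▸ hwτ)]

/-- A face on side `τ` is bounded by a cycle with 5 vertices, one of which must lie off `c`. Being
in the closure of the face, that vertex inherits its parity. -/
theorem exists_onSide (hG : G.IsPentagulation) {v : G.verts} {c : G.graph.Walk v v}
    (hc : c.IsCycle) (hlen : c.length ≤ 4) (τ : ZMod 2) : ∃ w, OnSide c τ w := by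
  classical
  obtain ⟨y, hy⟩ := hc.exists_mem_edges c.start_mem_support
  obtain ⟨F, hF, -, hFτ⟩ := exists_face_of_mem_edges hG hc hy τ
  obtain ⟨u, b, hb5, hb, hbF⟩ := hG F hF
  have hex : ∃ w ∈ b.support, w ∉ c.support := by
    by_contra! hcon
    have h1 : b.support.tail.toFinset ⊆ c.support.tail.toFinset := by
      intro w hw
      rw [List.mem_toFinset] at hw ⊢
      have hw' := hcon w (List.mem_of_mem_tail hw)
      rcases SimpleGraph.Walk.mem_support_iff c |>.1 hw' with rfl | h
      · exact SimpleGraph.Walk.end_mem_tail_support hc.not_nil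
      · exact h
    have h2 := Finset.card_le_card h1
    rw [List.toFinset_card_of_nodup hb.support_nodup,
      List.toFinset_card_of_nodup hc.support_nodup] at h2
    simp at h2
    omega
  obtain ⟨w, hw, hwc⟩ := hex
  refine ⟨w, hwc, ?_⟩
  have hwF : (w : Plane) ∈ closure F := by
    have : (w : Plane) ∈ G.walkPointSet b := coe_mem_walkPointSet.2 hw
    rw [← hbF] at this
    exact frontier_subset_closure this
  obtain ⟨z, hz, hz'⟩ := ((mem_closure_iff_frequently.1 hwF).and_eventually
    (eventually_parity_eq c fun h => hwc (coe_mem_walkPointSet.1 h))).exists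
  rw [← hz', hFτ z hz]

/-- The edge lies on the cycle bounding a face, and that cycle leaves `u` by another edge. -/
theorem exists_adj_ne (hG : G.IsPentagulation) {u v : G.verts} (h : G.graph.Adj u v) :
    ∃ w, w ≠ v ∧ G.graph.Adj u w := by
  obtain ⟨F₁, F₂, hF⟩ := exists_isFacePair hG h
  obtain ⟨x, c, -, hc⟩ := hG F₁ hF.left_mem
  obtain ⟨w, hw, hw'⟩ := hc.1.exists_ne_mem_edges
    ((hF.mem_edges_iff F₁ hF.left_mem x c hc).2 (Or.inl rfl))
  exact ⟨w, hw, c.adj_of_mem_edges hw'⟩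

theorem OnSide.of_adj {v : G.verts} {c : G.graph.Walk v v} {τ : ZMod 2} {w u : G.verts}
    (hw : OnSide c τ w) (h : G.graph.Adj w u) : u ∈ c.support ∨ OnSide c τ u := by
  by_cases hu : u ∈ c.support
  · exact Or.inl hu
  · exact Or.inr ⟨hu, (parity_eq_of_adj c h hw.1 hu).symm.trans hw.2⟩

/-! ### Descent through triangles and quadrilaterals. -/

/-- The closed walk around a triangle. -/
def triangle {a b c : G.verts} (hab : G.graph.Adj a b) (hbc : G.graph.Adj b c)
    (hca : G.graph.Adj c a) : G.graph.Walk a a :=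
  .cons hab (.cons hbc (.cons hca .nil))

theorem isCycle_triangle {a b c : G.verts} (hab : G.graph.Adj a b) (hbc : G.graph.Adj b c)
    (hca : G.graph.Adj c a) : (triangle hab hbc hca).IsCycle := by
  simp [triangle, SimpleGraph.Walk.cons_isCycle_iff, hab.ne, hbc.ne, hca.ne, hab.ne', hca.ne']

/-- The closed walk around a quadrilateral. -/
def quadrilateral {a b c d : G.verts} (hab : G.graph.Adj a b) (hbc : G.graph.Adj b c)
    (hcd : G.graph.Adj c d) (hda : G.graph.Adj d a) : G.graph.Walk a a :=
  .cons hab (.cons hbc (.cons hcd (.cons hda .nil)))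

theorem isCycle_quadrilateral {a b c d : G.verts} (hab : G.graph.Adj a b) (hbc : G.graph.Adj b c)
    (hcd : G.graph.Adj c d) (hda : G.graph.Adj d a) (hac : a ≠ c) (hbd : b ≠ d) :
    (quadrilateral hab hbc hcd hda).IsCycle := by
  simp [quadrilateral, SimpleGraph.Walk.cons_isCycle_iff, hab.ne, hbc.ne, hcd.ne, hda.ne, hab.ne',
    hda.ne', hac, hac.symm, hbd]

/-- A triangle, or a quadrilateral with two consecutive vertices satisfying `P`. -/
def IsSmallCycle (P : G.verts → Prop) {v : G.verts} (c : G.graph.Walk v v) : Prop :=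
  (∀ x ∈ c.support, ∀ y ∈ c.support, x ≠ y → s(x, y) ∈ c.edges) ∨
    ∃ t t' p' p, P p ∧ P p' ∧ s(t, t') ∈ c.edges ∧ s(t', p') ∈ c.edges ∧ s(p', p) ∈ c.edges ∧
      s(p, t) ∈ c.edges ∧ t ≠ p' ∧ t' ≠ p ∧ ∀ x ∈ c.support, x = t ∨ x = t' ∨ x = p' ∨ x = p

theorem isSmallCycle_triangle (P : G.verts → Prop) {a b c : G.verts} (hab : G.graph.Adj a b)
    (hbc : G.graph.Adj b c) (hca : G.graph.Adj c a) : IsSmallCycle P (triangle hab hbc hca) := by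
  left
  intro x hx y hy hxy
  simp only [triangle, SimpleGraph.Walk.support_cons, SimpleGraph.Walk.support_nil,
    List.mem_cons, List.not_mem_nil, or_false] at hx hy
  simp only [triangle, SimpleGraph.Walk.edges_cons, SimpleGraph.Walk.edges_nil,
    List.mem_cons, List.not_mem_nil, or_false, Sym2.eq_iff]
  rcases hx with rfl | rfl | rfl | rfl <;> rcases hy with rfl | rfl | rfl | rfl <;> tauto

theorem isSmallCycle_quadrilateral {P : G.verts → Prop} {a b c d : G.verts}
    (hab : G.graph.Adj a b) (hbc : G.graph.Adj b c) (hcd : G.graph.Adj c d) (hda : G.graph.Adj d a)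
    (hac : a ≠ c) (hbd : b ≠ d) (hc : P c) (hd : P d) :
    IsSmallCycle P (quadrilateral hab hbc hcd hda) := by
  right
  refine ⟨a, b, c, d, hd, hc, ?_, ?_, ?_, ?_, hac, hbd, ?_⟩
  · simp [quadrilateral]
  · simp [quadrilateral]
  · simp [quadrilateral]
  · simp [quadrilateral]
  · intro x hx
    simp only [quadrilateral, SimpleGraph.Walk.support_cons, SimpleGraph.Walk.support_nil,
      List.mem_cons, List.not_mem_nil, or_false] at hx
    tauto

/-- A side of a cycle within a closed side of another cycle, but through a vertex in its interior,
has fewer vertices. -/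
theorem exists_side_subset_card_lt (hG : G.IsPentagulation) {v v' : G.verts}
    {c : G.graph.Walk v v} {c' : G.graph.Walk v' v'} (hc : c.IsCycle) (hc' : c'.IsCycle)
    {τ : ZMod 2}
    (h : ∀ x y, s(x, y) ∈ c'.edges → s(x, y) ∈ c.edges ∨ OnSide c τ x ∨ OnSide c τ y)
    {w : G.verts} (hw : w ∈ c'.support) (hwτ : OnSide c τ w) :
    ∃ τ', (∀ u, OnSide c' τ' u → OnSide c τ u) ∧
      {u | OnSide c' τ' u}.ncard < {u | OnSide c τ u}.ncard := by
  obtain ⟨τ', hτ'⟩ := exists_side_subset hG hc hc' h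
  refine ⟨τ', hτ', Set.ncard_lt_ncard ⟨hτ', fun hsub => ?_⟩ (Set.toFinite _)⟩
  exact (hsub (show w ∈ {u | OnSide c τ u} from hwτ)).1 hw

/-- No side of a triangle or quadrilateral as in `IsSmallCycle` consists of vertices satisfying `P`,
if these are all adjacent to a set of vertices not satisfying `P`. -/
theorem false_of_isSmallCycle (hG : G.IsPentagulation) {P : G.verts → Prop} {S : Set G.verts}
    (hS : ∀ w ∈ S, ¬ P w) (hP : ∀ w, P w → ∃ t ∈ S, G.graph.Adj w t)
    (n : ℕ) : ∀ (v : G.verts) (c : G.graph.Walk v v) (τ : ZMod 2), c.IsCycle → c.length ≤ 4 →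
      IsSmallCycle P c → (∀ w, OnSide c τ w → P w) → {u | OnSide c τ u}.ncard = n → False := by
  induction n using Nat.strong_induction_on with
  | _ n ih =>
  intro v c τ hc hlen hsmall hsub hn
  subst hn
  -- A triangle through an interior vertex `w`, inside the closed side, contradicts the induction
  -- hypothesis. `hquad` is the analogue for a quadrilateral built on an edge of `c`.
  have htri : ∀ t w u, G.graph.Adj t w → G.graph.Adj w u → G.graph.Adj u t → OnSide c τ w →
      (s(u, t) ∈ c.edges ∨ OnSide c τ u) → False := by
    intro t w u htw hwu hut hw hu
    obtain ⟨τ', h1, h2⟩ := exists_side_subset_card_lt hG hc (isCycle_triangle htw hwu hut) (τ := τ)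
      (fun x y hxy => by
        simp only [triangle, SimpleGraph.Walk.edges_cons, SimpleGraph.Walk.edges_nil,
          List.mem_cons, List.not_mem_nil, or_false] at hxy
        rcases hxy with hxy | hxy | hxy
        · rcases Sym2.eq_iff.1 hxy with ⟨rfl, rfl⟩ | ⟨rfl, rfl⟩ <;> tauto
        · rcases Sym2.eq_iff.1 hxy with ⟨rfl, rfl⟩ | ⟨rfl, rfl⟩ <;> tauto
        · rcases hu with hu | hu
          · rw [hxy]; exact Or.inl hu
          · rcases Sym2.eq_iff.1 hxy with ⟨rfl, rfl⟩ | ⟨rfl, rfl⟩ <;> tauto)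
      (w := w) (by simp [triangle]) hw
    exact ih _ h2 _ _ τ' (isCycle_triangle htw hwu hut) (by simp [triangle])
      (isSmallCycle_triangle P htw hwu hut) (fun w hw => hsub w (h1 w hw)) rfl
  have hquad : ∀ t t' u w, s(t, t') ∈ c.edges → G.graph.Adj t' u → G.graph.Adj u w →
      G.graph.Adj w t → t ≠ u → OnSide c τ w → (s(t', u) ∈ c.edges ∨ OnSide c τ u) → P u →
      False := by
    intro t t' u w htt htu huw hwt htu' hw hu hPu
    have hadj := c.adj_of_mem_edges htt
    have htw : t' ≠ w := by
      rintro rfl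
      exact hw.1 (c.snd_mem_support_of_mem_edges htt)
    have hcyc := isCycle_quadrilateral hadj htu huw hwt htu' htw
    obtain ⟨τ', h1, h2⟩ := exists_side_subset_card_lt hG hc hcyc (τ := τ)
      (fun x y hxy => by
        simp only [quadrilateral, SimpleGraph.Walk.edges_cons, SimpleGraph.Walk.edges_nil,
          List.mem_cons, List.not_mem_nil, or_false] at hxy
        rcases hxy with hxy | hxy | hxy | hxy
        · rw [hxy]; exact Or.inl htt
        · rcases hu with hu | hu
          · rw [hxy]; exact Or.inl hu
          · rcases Sym2.eq_iff.1 hxy with ⟨rfl, rfl⟩ | ⟨rfl, rfl⟩ <;> tauto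
        · rcases Sym2.eq_iff.1 hxy with ⟨rfl, rfl⟩ | ⟨rfl, rfl⟩ <;> tauto
        · rcases Sym2.eq_iff.1 hxy with ⟨rfl, rfl⟩ | ⟨rfl, rfl⟩ <;> tauto)
      (w := w) (by simp [quadrilateral]) hw
    exact ih _ h2 _ _ τ' hcyc (by simp [quadrilateral])
      (isSmallCycle_quadrilateral hadj htu huw hwt htu' htw hPu (hsub w hw))
      (fun w hw => hsub w (h1 w hw)) rfl
  -- The neighbour in `S` cannot be inside, since all vertices there satisfy `P`; hence it is on the
  -- current cycle.
  have hattach : ∀ w, OnSide c τ w → ∃ t ∈ S, t ∈ c.support ∧ G.graph.Adj w t := by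
    intro w hw
    obtain ⟨t, ht, hadj⟩ := hP w (hsub w hw)
    exact ⟨t, ht, (hw.of_adj hadj).resolve_right fun h => hS t ht (hsub t h), hadj⟩
  obtain ⟨w, hw⟩ := exists_onSide hG hc hlen τ
  obtain ⟨t, htS, htc, hwt⟩ := hattach w hw
  obtain ⟨u, hut, hwu⟩ := exists_adj_ne hG hwt
  have hu := hw.of_adj hwu
  rcases hsmall with hsmall | ⟨r, r', p', p, hPp, hPp', hrr, hrp', hpp, hpr, hne, hne', hsupp⟩
  · rcases hu with hu | hu
    · have hs := hsmall u hu t htc hut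
      exact htri t w u hwt.symm hwu (c.adj_of_mem_edges hs) hw (Or.inl hs)
    · obtain ⟨t', htS', htc', hut'⟩ := hattach u hu
      by_cases htt : t = t'
      · subst htt
        exact htri t w u hwt.symm hwu hut' hw (Or.inr hu)
      · exact hquad t t' u w (hsmall t htc t' htc' htt) hut'.symm hwu.symm hwt hut.symm hw
          (Or.inr hu) (hsub u hu)
  -- In a quadrilateral only `r` and `r'` can belong to `S`, so attachments occur only there.
  -- Reflection exchanges the two, so `t = r` may be assumed.
  · have main : ∀ r r' p' p, P p → P p' → s(r, r') ∈ c.edges → s(r', p') ∈ c.edges →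
        s(p, r) ∈ c.edges → r ≠ p' →
        (∀ x ∈ c.support, x = r ∨ x = r' ∨ x = p' ∨ x = p) → t = r → False := by
      rintro r r' p' p hPp hPp' hrr hrp' hpr hne hsupp rfl
      rcases hu with hu | hu
      · rcases hsupp u hu with rfl | rfl | rfl | rfl
        · exact hut rfl
        · rw [Sym2.eq_swap] at hrr
          exact htri t w u hwt.symm hwu (c.adj_of_mem_edges hrr) hw (Or.inl hrr)
        · exact hquad t r' u w hrr (c.adj_of_mem_edges hrp') hwu.symm hwt hne hw (Or.inl hrp') hPp'
        · exact htri t w u hwt.symm hwu (c.adj_of_mem_edges hpr) hw (Or.inl hpr)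
      · obtain ⟨t', htS', htc', hut'⟩ := hattach u hu
        rcases hsupp t' htc' with rfl | rfl | rfl | rfl
        · exact htri t' w u hwt.symm hwu hut' hw (Or.inr hu)
        · exact hquad t t' u w hrr hut'.symm hwu.symm hwt hut.symm hw (Or.inr hu) (hsub u hu)
        · exact hS _ htS' hPp'
        · exact hS _ htS' hPp
    rcases hsupp t htc with h | h | h | h
    · exact main r r' p' p hPp hPp' hrr hrp' hpr hne hsupp h
    · refine main r' r p p' hPp' hPp ?_ ?_ ?_ hne' (fun x hx => ?_) h
      · rwa [Sym2.eq_swap]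
      · rwa [Sym2.eq_swap]
      · rwa [Sym2.eq_swap]
      · have := hsupp x hx; tauto
    · exact hS _ htS (h ▸ hPp')
    · exact hS _ htS (h ▸ hPp)

/-! ### Vertices far from a triangle and the distance between them. -/

/-- Each side of a triangle contains a vertex which is not adjacent to the triangle. -/
theorem exists_onSide_not_adj (hG : G.IsPentagulation) {a b c : G.verts} (hab : G.graph.Adj a b)
    (hbc : G.graph.Adj b c) (hca : G.graph.Adj c a) (τ : ZMod 2) :
    ∃ w, OnSide (triangle hab hbc hca) τ w ∧
      ∀ t ∈ (triangle hab hbc hca).support, ¬ G.graph.Adj w t := by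
  by_contra! hcon
  exact false_of_isSmallCycle hG (P := OnSide (triangle hab hbc hca) τ)
    (S := {t | t ∈ (triangle hab hbc hca).support}) (fun w hw h => h.1 hw) hcon _ a
    (triangle hab hbc hca) τ (isCycle_triangle hab hbc hca) (by simp [triangle])
    (isSmallCycle_triangle _ hab hbc hca) (fun _ h => h) rfl

/-- A walk between vertices which lie on different sides of a closed walk, and are not adjacent to
it, has length at least four. -/
theorem four_le_length {v : G.verts} {c : G.graph.Walk v v} {x y : G.verts} (hx : x ∉ c.support)
    (hy : y ∉ c.support) (hxy : parity c x ≠ parity c y)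
    (hx' : ∀ t ∈ c.support, ¬ G.graph.Adj x t) (hy' : ∀ t ∈ c.support, ¬ G.graph.Adj y t)
    (w : G.graph.Walk x y) : 4 ≤ w.length := by
  -- On a walk of at most three edges every inner vertex is adjacent to `x` or `y`, hence off `c`,
  -- so parity would be the same at both ends.
  have hstep : ∀ {r s : G.verts}, G.graph.Adj r s → r ∉ c.support → s ∉ c.support →
      parity c r = parity c s := fun h => parity_eq_of_adj c h
  match w with
  | .nil => exact absurd rfl hxy
  | .cons h .nil => exact absurd (hstep h hx hy) hxy
  | .cons (v := r) h (.cons h' .nil) =>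
    have hr : r ∉ c.support := fun hr => hx' r hr h
    exact absurd ((hstep h hx hr).trans (hstep h' hr hy)) hxy
  | .cons (v := r) h (.cons (v := s) h' (.cons h'' .nil)) =>
    have hr : r ∉ c.support := fun hr => hx' r hr h
    have hs : s ∉ c.support := fun hs => hy' s hs h''.symm
    exact absurd (((hstep h hx hr).trans (hstep h' hr hs)).trans (hstep h'' hs hy)) hxy
  | .cons _ (.cons _ (.cons _ (.cons _ _))) => simp

end PlaneGraph

theorem mainTheorem7 (G : PlaneGraph) (hG : G.IsPentagulation) (hdiam : G.graph.ediam = 3) :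
    ¬ ∃ (v : G.verts) (c : G.graph.Walk v v), c.IsCycle ∧ c.length = 3 := by
  rintro ⟨v, c, hc, hlen⟩
  obtain ⟨s, hs⟩ := SimpleGraph.is3Clique_iff_exists_cycle_length_three.2 ⟨v, c, hc, hlen⟩
  classical
  obtain ⟨x, y, z, hxy, hxz, hyz, -⟩ := SimpleGraph.is3Clique_iff.1 hs
  obtain ⟨p, hp, hp'⟩ := PlaneGraph.exists_onSide_not_adj hG hxy hyz hxz.symm 0
  obtain ⟨q, hq, hq'⟩ := PlaneGraph.exists_onSide_not_adj hG hxy hyz hxz.symm 1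
  have hle : G.graph.edist p q ≤ 3 := hdiam ▸ SimpleGraph.edist_le_ediam
  have hne : G.graph.edist p q ≠ ⊤ := ne_top_of_le_ne_top (by decide) hle
  obtain ⟨w, hw⟩ := SimpleGraph.exists_walk_of_edist_ne_top hne
  have h4 := PlaneGraph.four_le_length hp.1 hq.1 (by rw [hp.2, hq.2]; decide) hp' hq' w
  rw [← hw] at hle
  have h3 : w.length ≤ 3 := by exact_mod_cast hle
  omega
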